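/- Let $d\ge 3$. For $p\in[0,1]$ consider Bernoulli bond percolation on $\mathbb{Z}^d$: the edges (pairs of vertices at Euclidean distance one) are independently open with probability $p$ and closed with probability $1-p$; let $\mathbb{P}_p$ be the corresponding probability measure. The bond of an edge is the closed segment of $\mathbb{R}^d$ joining its endpoints, and it is open or closed according to its edge. A sphere is a subset of $\mathbb{R}^d$ that is the underlying space of a finite geometric simplicial complex and is homeomorphic to the Euclidean unit sphere $S^{d-1}$; its inside is the unique bounded connected component of its complement. Let $\mathcal{S}$ be the event that there is a sphere that does not meet $\mathbb{Z}^d$, has the origin in its inside, and intersects only closed bonds, and put $$p_c^S:=\inf\{p\in[0,1] : \mathbb{P}_p(\mathcal{S})=0\}.$$ For $A\subset\mathbb{R}^d$ let $\mathrm{rad}[A]:=\sup\{\sum_{i=1}^d|x_i| : x\in A\}\in[0,\infty]$. Then $$p_c^S\ \ge\ \frac{1}{8(d-1)}.$$ Moreover, for all $p\in[0,1]$ with $p<\frac1{8(d-1)}$ and all $\alpha\in(\sqrt{8p(d-1)},\,1)$, there exist a constant $C>0$ and a random set $S$, given by a map $\omega\mapsto S(\omega)\subset\mathbb{R}^d$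 on percolation configurations that is measurable in the sense that $\{S\cap U\ne\emptyset\}$ is an event for every open $U\subset\mathbb{R}^d$, such that $\mathbb{P}_p$-almost surely $S$ is a sphere that does not meet $\mathbb{Z}^d$, has the origin in its inside and intersects only closed bonds, and $$\mathbb{P}_p(\mathrm{rad}[S]\ge r)\ \le\ C\alpha^r\qquad\text{for all real } r>0 .$$ -/

import Mathlib

open MeasureTheory
open scoped ENNReal unitInterval

namespace SpherePercolation

noncomputable section

/-- The hypercubic lattice on `ℤ^d`: two vertices are neighbours when their Euclidean distance
is one, that is, when the squared distance is one. -/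
def lattice (d : ℕ) : SimpleGraph (Fin d → ℤ) where
  Adj x y := ∑ i, (x i - y i) ^ 2 = 1
  symm := ⟨fun x y h => by
    rw [← h]
    exact Finset.sum_congr rfl fun i _ => by ring⟩
  loopless := ⟨fun x h => by simp at h⟩

/-- A percolation configuration: `true` means that the edge is open, `false` that it is closed. -/
abbrev Config (d : ℕ) : Type := (lattice d).edgeSet → Bool

/-- Bernoulli bond percolation: the edges are independently open with probability `p` and closed
with probability `1 - p`. -/
def percMeasure (d : ℕ) (p : I) : Measure (Config d) :=
  Measure.infinitePi fun _ => ProbabilityTheory.bernoulliMeasure true false p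

instance (d : ℕ) (p : I) : IsProbabilityMeasure (percMeasure d p) := by
  unfold percMeasure
  infer_instance

/-- The inclusion of `ℤ^d` into `ℝ^d`. -/
def toSpace {d : ℕ} (v : Fin d → ℤ) : EuclideanSpace ℝ (Fin d) :=
  WithLp.toLp 2 fun i => (v i : ℝ)

/-- The bond between two neighbours: the closed segment in `ℝ^d` that joins them. -/
def bond {d : ℕ} (v w : Fin d → ℤ) : Set (EuclideanSpace ℝ (Fin d)) :=
  segment ℝ (toSpace v) (toSpace w)

/-- A sphere in `ℝ^d`: the underlying space of a (finite) geometric simplicial complex that is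
homeomorphic to the Euclidean unit sphere `S^{d-1}`. Without finiteness, the
family of all singletons of a set would count as a triangulation of it. -/
def IsSphere {d : ℕ} (A : Set (EuclideanSpace ℝ (Fin d))) : Prop :=
  (∃ K : Geometry.SimplicialComplex ℝ (EuclideanSpace ℝ (Fin d)),
    K.faces.Finite ∧ K.space = A) ∧
  Nonempty (A ≃ₜ Metric.sphere (0 : EuclideanSpace ℝ (Fin d)) 1)

/-- The points of the complement of `A` whose connected component in that complement is bounded.
When `A` is a sphere, this is the unique bounded component of the complement. -/
def inside {d : ℕ} (A : Set (EuclideanSpace ℝ (Fin d))) : Set (EuclideanSpace ℝ (Fin d)) :=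
  {x | x ∈ Aᶜ ∧ Bornology.IsBounded (connectedComponentIn Aᶜ x)}

/-- In the configuration `ω`, every bond that meets `A` is closed. -/
def MeetsOnlyClosedBonds {d : ℕ} (ω : Config d) (A : Set (EuclideanSpace ℝ (Fin d))) : Prop :=
  ∀ (v w : Fin d → ℤ) (h : (lattice d).Adj v w),
    (bond v w ∩ A).Nonempty → ω ⟨s(v, w), h⟩ = false

/-- `A` is a sphere that does not meet `ℤ^d`, has the origin in its inside and intersects
only bonds that are closed in `ω`. -/
def IsClosedSphereAroundOrigin {d : ℕ} (ω : Config d)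
    (A : Set (EuclideanSpace ℝ (Fin d))) : Prop :=
  IsSphere A ∧ (∀ v : Fin d → ℤ, toSpace v ∉ A) ∧ 0 ∈ inside A ∧ MeetsOnlyClosedBonds ω A

/-- The event `𝒮`: there is a sphere intersecting only closed bonds, with the origin inside. -/
def sphereEvent (d : ℕ) : Set (Config d) :=
  {ω | ∃ A, IsClosedSphereAroundOrigin ω A}

/-- The critical probability `p_c^S = inf {p ∈ [0,1] : P_p(𝒮) = 0}`. -/
def criticalProb (d : ℕ) : ℝ :=
  sInf {p : ℝ | ∃ hp : p ∈ I, percMeasure d ⟨p, hp⟩ (sphereEvent d) = 0}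

/-- The `ℓ¹`-radius of a set, seen from the origin, with values in `[0,∞]`. -/
def rad {d : ℕ} (A : Set (EuclideanSpace ℝ (Fin d))) : ℝ≥0∞ :=
  ⨆ x ∈ A, ENNReal.ofReal (∑ i, |x i|)

/-- Measurability of a random subset of `ℝ^d` in the usual sense for random closed sets (Effros):
hitting a given open set is a measurable event. -/
def IsMeasurableSetValued {d : ℕ} (S : Config d → Set (EuclideanSpace ℝ (Fin d))) : Prop :=
  ∀ U : Set (EuclideanSpace ℝ (Fin d)), IsOpen U → MeasurableSet {ω | (S ω ∩ U).Nonempty}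

end

end SpherePercolation

/-! Explore the lattice from the origin: a step from a vertex to its parent (last nonzero coordinate
moved one step towards zero) is always allowed, any other step needs an open edge. If the set `H` of
reached vertices is finite, all edges leaving it are closed, so it suffices to enclose `H` in a
polyhedral sphere that meets only edges between `H` and its complement.

The free steps make this sphere explicit. They turn `H` into a comb, and a comb can be thickened to
a region in which each coordinate `x k` ranges between two heights that depend on the earlier
coordinates only. Dividing each coordinate by its height is a triangular map that carries the region
to a cube; hence the boundary is homeomorphic to the unit sphere and surrounds the origin. The
heights arise from affine functions by maxima and minima, so the boundary is compact and semilinear,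
and `exists_simplicialComplex_of_isSemilinear` triangulates it by chains of sign cells. The lattice
geometry is in `OnEdge.mem_xor`: an edge that meets the boundary has exactly one end in `H`.

Finiteness and the tail come from a union bound over self-avoiding paths. A path with `a` non-parent
steps and `b` parent steps is usable with probability `p ^ a`, and its end has ℓ¹-norm at most `a -
b`. Writing `p = q * u` with `u ≤ 1`, this probability is at most `u ^ (ℓ¹-norm of the end)` times
`q ^ a * u ^ b`. After the first step a path has at most `2d - 1` continuations, at most one of them
to a parent, so the total weight of `n`-step paths decays like the `n`-th power of `(2d - 2) q + u`.
For `u = α / 2` the inequality `8 p (d - 1) < α ^ 2` makes this ratio less than one, and norm `r` is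
reached with probability of order `u ^ r ≤ α ^ r`.

Thus below the threshold a closed sphere exists almost surely, so the sphere event is not null
there; this bounds the infimum. -/

namespace SpherePercolation

/-! ### Semilinear sets and piecewise linear functions -/

section Semilinear

variable {E : Type*} [AddCommGroup E] [Module ℝ E]

/-- A set is semilinear if membership depends only on the signs of finitely many affine
functionals. -/
def IsSemilinear (A : Set E) : Prop :=
  ∃ F : Finset (E →ᵃ[ℝ] ℝ), ∀ x y, (∀ f ∈ F, SignType.sign (f x) = SignType.sign (f y)) →
    x ∈ A → y ∈ A

theorem IsSemilinear.compl {A : Set E} (hA : IsSemilinear A) : IsSemilinear Aᶜ := by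
  obtain ⟨F, hF⟩ := hA
  exact ⟨F, fun x y h hx hy => hx (hF y x (fun f hf => (h f hf).symm) hy)⟩

theorem IsSemilinear.iInter {ι : Type*} [Finite ι] {A : ι → Set E}
    (hA : ∀ i, IsSemilinear (A i)) : IsSemilinear (⋂ i, A i) := by
  classical
  have := Fintype.ofFinite ι
  choose F hF using hA
  refine ⟨Finset.univ.biUnion F, fun x y h hx => ?_⟩
  rw [Set.mem_iInter] at hx ⊢
  exact fun i => hF i x y
    (fun f hf => h f (Finset.mem_biUnion.2 ⟨i, Finset.mem_univ i, hf⟩)) (hx i)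

theorem IsSemilinear.iUnion {ι : Type*} [Finite ι] {A : ι → Set E}
    (hA : ∀ i, IsSemilinear (A i)) : IsSemilinear (⋃ i, A i) := by
  have := (IsSemilinear.iInter fun i => (hA i).compl).compl
  rwa [← Set.compl_iUnion, compl_compl] at this

theorem IsSemilinear.inter {A B : Set E} (hA : IsSemilinear A) (hB : IsSemilinear B) :
    IsSemilinear (A ∩ B) := by
  rw [Set.inter_eq_iInter]
  exact IsSemilinear.iInter (by rintro (_ | _) <;> assumption)

theorem IsSemilinear.union {A B : Set E} (hA : IsSemilinear A) (hB : IsSemilinear B) :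
    IsSemilinear (A ∪ B) := by
  rw [Set.union_eq_iUnion]
  exact IsSemilinear.iUnion (by rintro (_ | _) <;> assumption)

theorem isSemilinear_nonneg (f : E →ᵃ[ℝ] ℝ) : IsSemilinear {x | 0 ≤ f x} := by
  refine ⟨{f}, fun x y h hx => ?_⟩
  have h := h f (Finset.mem_singleton_self f)
  simp only [Set.mem_ofPred_eq] at hx ⊢
  rw [← sign_nonneg_iff, ← h, sign_nonneg_iff]
  exact hx

theorem isSemilinear_le (f g : E →ᵃ[ℝ] ℝ) : IsSemilinear {x | f x ≤ g x} := by
  have := isSemilinear_nonneg (g - f)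
  simpa using this

/-- A function is piecewise linear, for our purposes, if its comparisons with affine functions
define semilinear sets. -/
def IsPiecewiseLinear (f : E → ℝ) : Prop :=
  ∀ g : E →ᵃ[ℝ] ℝ, IsSemilinear {x | f x ≤ g x} ∧ IsSemilinear {x | g x ≤ f x}

theorem isPiecewiseLinear_affine (f : E →ᵃ[ℝ] ℝ) : IsPiecewiseLinear f :=
  fun g => ⟨isSemilinear_le f g, isSemilinear_le g f⟩

theorem isPiecewiseLinear_const (c : ℝ) : IsPiecewiseLinear fun _ : E => c :=
  isPiecewiseLinear_affine (AffineMap.const ℝ E c)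

theorem IsPiecewiseLinear.neg {f : E → ℝ} (hf : IsPiecewiseLinear f) :
    IsPiecewiseLinear fun x => -f x := by
  intro g
  obtain ⟨h1, h2⟩ := hf (-g)
  simp only [AffineMap.coe_neg, Pi.neg_apply] at h1 h2
  constructor
  · convert h2 using 3
    exact neg_le
  · convert h1 using 3
    exact le_neg

/-- The affine comparison function absorbs an affine summand. This does not work for two piecewise
linear summands, so the heights below are built without such sums. -/
theorem IsPiecewiseLinear.add_affine {f : E → ℝ} (hf : IsPiecewiseLinear f) (a : E →ᵃ[ℝ] ℝ) :
    IsPiecewiseLinear fun x => a x + f x := by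
  intro g
  obtain ⟨h1, h2⟩ := hf (g - a)
  simp only [AffineMap.coe_sub, Pi.sub_apply] at h1 h2
  constructor
  · convert h1 using 3
    exact le_sub_iff_add_le'.symm
  · convert h2 using 3
    exact sub_le_iff_le_add'.symm

theorem IsPiecewiseLinear.const_add {f : E → ℝ} (hf : IsPiecewiseLinear f) (c : ℝ) :
    IsPiecewiseLinear fun x => c + f x :=
  hf.add_affine (AffineMap.const ℝ E c)

theorem IsPiecewiseLinear.const_mul {f : E → ℝ} (hf : IsPiecewiseLinear f) {c : ℝ}
    (hc : 0 ≤ c) : IsPiecewiseLinear fun x => c * f x := by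
  rcases hc.eq_or_lt with rfl | hc
  · simpa using isPiecewiseLinear_const (E := E) 0
  · intro g
    obtain ⟨h1, h2⟩ := hf (c⁻¹ • g)
    simp only [AffineMap.coe_smul, Pi.smul_apply, smul_eq_mul] at h1 h2
    constructor
    · convert h1 using 3
      exact (le_inv_mul_iff₀ hc).symm
    · convert h2 using 3
      exact (inv_mul_le_iff₀ hc).symm

theorem IsPiecewiseLinear.max {f g : E → ℝ} (hf : IsPiecewiseLinear f)
    (hg : IsPiecewiseLinear g) : IsPiecewiseLinear fun x => max (f x) (g x) := by
  intro a
  constructor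
  · convert (hf a).1.inter (hg a).1 using 1
    ext x; simp
  · convert (hf a).2.union (hg a).2 using 1
    ext x; simp

theorem IsPiecewiseLinear.min {f g : E → ℝ} (hf : IsPiecewiseLinear f)
    (hg : IsPiecewiseLinear g) : IsPiecewiseLinear fun x => min (f x) (g x) := by
  intro a
  constructor
  · convert (hf a).1.union (hg a).1 using 1
    ext x; simp
  · convert (hf a).2.inter (hg a).2 using 1
    ext x; simp

/-- The sup norm is a finite maximum of absolute values; the additional comparison with zero also
covers an empty index type. -/
theorem IsPiecewiseLinear.pi_norm {J : Type*} [Fintype J] {f : J → E → ℝ}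
    (hf : ∀ j, IsPiecewiseLinear (f j)) : IsPiecewiseLinear fun x => ‖fun j => f j x‖ := by
  have habs : ∀ j, IsPiecewiseLinear fun x => |f j x| := fun j => (hf j).max (hf j).neg
  intro a
  have h1 := isPiecewiseLinear_const (E := E) 0 a
  constructor
  · convert h1.1.inter (IsSemilinear.iInter fun j => (habs j a).1) using 1
    ext x
    simp only [Set.mem_inter_iff, Set.mem_iInter, Set.mem_ofPred_eq]
    constructor
    · intro h
      exact ⟨(norm_nonneg _).trans h, fun j => (norm_le_pi_norm (fun j => f j x) j).trans h⟩
    · rintro ⟨h0, h⟩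
      exact (pi_norm_le_iff_of_nonneg h0).2 h
  · convert h1.2.union (IsSemilinear.iUnion fun j => (habs j a).2) using 1
    ext x
    simp only [Set.mem_union, Set.mem_iUnion, Set.mem_ofPred_eq]
    constructor
    · intro h
      by_contra! hc
      exact absurd h (not_le.2 ((pi_norm_lt_iff hc.1).2 hc.2))
    · rintro (h | ⟨j, h⟩)
      · exact h.trans (norm_nonneg _)
      · exact h.trans (norm_le_pi_norm (fun j => f j x) j)

end Semilinear

/-! ### The face order on sign vectors -/

section SignOrder

variable {ι : Type*}

/-- The face relation between sign vectors: `τ` arises from `κ` by replacing signs by zero. -/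
def IsSignFace (τ κ : ι → SignType) : Prop := ∀ i, τ i = 0 ∨ τ i = κ i

theorem IsSignFace.refl (κ : ι → SignType) : IsSignFace κ κ := fun _ => Or.inr rfl

theorem IsSignFace.trans {ρ τ κ : ι → SignType} (h : IsSignFace ρ τ) (h' : IsSignFace τ κ) :
    IsSignFace ρ κ := by
  intro i
  rcases h i with h0 | h0
  · exact Or.inl h0
  · rw [h0]; exact h' i

theorem IsSignFace.antisymm {τ κ : ι → SignType} (h : IsSignFace τ κ) (h' : IsSignFace κ τ) :
    τ = κ := by
  funext i
  rcases h i with h0 | h0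
  · rcases h' i with h1 | h1
    · rw [h0, h1]
    · exact h1.symm
  · exact h0

/-- The number of nonzero signs. -/
def signRank [Fintype ι] (κ : ι → SignType) : ℕ := (Finset.univ.filter fun i => κ i ≠ 0).card

/-- Proper faces have strictly fewer nonzero signs; this allows induction over cells by rank. -/
theorem IsSignFace.eq_of_rank_le [Fintype ι] {τ κ : ι → SignType} (h : IsSignFace τ κ)
    (hr : signRank κ ≤ signRank τ) : τ = κ := by
  have hsub : (Finset.univ.filter fun i => τ i ≠ 0) ⊆ Finset.univ.filter fun i => κ i ≠ 0 := by
    intro i hi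
    rw [Finset.mem_filter] at hi ⊢
    rcases h i with h0 | h0
    · exact absurd h0 hi.2
    · exact ⟨hi.1, h0 ▸ hi.2⟩
  have heq := Finset.eq_of_subset_of_card_le hsub hr
  refine h.antisymm fun i => ?_
  rcases h i with h0 | h0
  · left
    by_contra hi
    have : i ∈ Finset.univ.filter fun i => τ i ≠ 0 := by
      rw [heq]; simpa using hi
    exact (Finset.mem_filter.1 this).2 h0
  · exact Or.inr h0.symm

end SignOrder

/-! ### Sign cells and chains of cells -/

section Triangulation

variable {E : Type*} [AddCommGroup E] [Module ℝ E]
variable {ι : Type*} (l : ι → E →ᵃ[ℝ] ℝ)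

/-- The vector of signs of a family of affine functionals at a point. -/
noncomputable def signVector (x : E) : ι → SignType := fun i => SignType.sign (l i x)

variable {l}

/-- A nonnegative combination of points of the faces of a cell, with a positive weight at a point
of the cell itself, has the signs of the cell. -/
theorem signVector_sum {J : Type*} (s : Finset J) (w : J → ℝ) (b : J → E)
    (hw : ∀ j ∈ s, 0 ≤ w j) {κ : ι → SignType}
    (hb : ∀ j ∈ s, IsSignFace (signVector l (b j)) κ) {j₀ : J} (hj₀ : j₀ ∈ s)
    (hκ : signVector l (b j₀) = κ) (hw₀ : 0 < w j₀) (i : ι) :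
    SignType.sign (∑ j ∈ s, w j * l i (b j)) = κ i := by
  have hsgn : ∀ j ∈ s, SignType.sign (l i (b j)) = 0 ∨ SignType.sign (l i (b j)) = κ i :=
    fun j hj => hb j hj i
  have h0 : SignType.sign (l i (b j₀)) = κ i := congrFun hκ i
  cases hc : κ i with
  | zero =>
    simp only [SignType.zero_eq_zero] at hc ⊢
    rw [sign_eq_zero_iff]
    refine Finset.sum_eq_zero fun j hj => ?_
    have : SignType.sign (l i (b j)) = 0 := by simpa [hc] using hsgn j hj
    rw [sign_eq_zero_iff.1 this, mul_zero]
  | pos =>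
    simp only [SignType.pos_eq_one] at hc ⊢
    rw [sign_eq_one_iff]
    rw [hc, sign_eq_one_iff] at h0
    refine Finset.sum_pos' (fun j hj => mul_nonneg (hw j hj) ?_) ⟨j₀, hj₀, mul_pos hw₀ h0⟩
    rcases hsgn j hj with h | h
    · rw [sign_eq_zero_iff.1 h]
    · rw [hc, sign_eq_one_iff] at h; exact h.le
  | neg =>
    simp only [SignType.neg_eq_neg_one] at hc ⊢
    rw [sign_eq_neg_one_iff]
    rw [hc, sign_eq_neg_one_iff] at h0
    rw [← neg_pos, ← Finset.sum_neg_distrib]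
    refine Finset.sum_pos' (fun j hj => ?_) ⟨j₀, hj₀, by nlinarith⟩
    rcases hsgn j hj with h | h
    · rw [sign_eq_zero_iff.1 h]; simp
    · rw [hc, sign_eq_neg_one_iff] at h
      nlinarith [hw j hj]

/-- The sums `∑ w_j l(b_j)` for an affine functional `l` are determined by the total weight and
the weighted sum of the points. -/
theorem sum_mul_affine {J : Type*} (s : Finset J) (w : J → ℝ) (b : J → E) (f : E →ᵃ[ℝ] ℝ) :
    ∑ j ∈ s, w j * f (b j) = f.linear (∑ j ∈ s, w j • b j) + (∑ j ∈ s, w j) * f 0 := by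
  have h : ∀ x, f x = f.linear x + f 0 := fun x => by
    have := f.map_vadd 0 x
    simpa using this
  rw [map_sum, Finset.sum_mul, ← Finset.sum_add_distrib]
  refine Finset.sum_congr rfl fun j _ => ?_
  rw [h (b j), map_smul, smul_eq_mul]
  ring

end Triangulation

section Triangulation

variable {E : Type*} [AddCommGroup E] [Module ℝ E] {ι : Type*} {l : ι → E →ᵃ[ℝ] ℝ}

/-- In a chain, an element of maximal rank is the top: whatever lies above it has no larger rank and
hence the same signs. -/
theorem exists_signVector_top [Fintype ι] {s : Finset E} (hs : s.Nonempty)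
    (hc : ∀ x ∈ s, ∀ y ∈ s, IsSignFace (signVector l x) (signVector l y) ∨
      IsSignFace (signVector l y) (signVector l x)) :
    ∃ y ∈ s, ∀ z ∈ s, IsSignFace (signVector l z) (signVector l y) := by
  obtain ⟨y, hy, hmax⟩ := s.exists_max_image (fun y => signRank (signVector l y)) hs
  refine ⟨y, hy, fun z hz => ?_⟩
  rcases hc z hz y hy with h | h
  · exact h
  · rw [h.eq_of_rank_le (hmax z hz)]
    exact IsSignFace.refl _

/-- A relation between points whose positive part and whose negative part are supported by
chains of the face relation is trivial. -/
theorem eq_zero_of_chain_relation [Fintype ι] {U : Finset E}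
    (hinj : Set.InjOn (signVector l) (U : Set E)) (d : E → ℝ)
    (hP : ∀ x ∈ U, ∀ y ∈ U, 0 < d x → 0 < d y → IsSignFace (signVector l x) (signVector l y) ∨
      IsSignFace (signVector l y) (signVector l x))
    (hN : ∀ x ∈ U, ∀ y ∈ U, d x < 0 → d y < 0 → IsSignFace (signVector l x) (signVector l y) ∨
      IsSignFace (signVector l y) (signVector l x))
    (h0 : ∑ x ∈ U, d x = 0) (h1 : ∑ x ∈ U, d x • x = 0) : ∀ x ∈ U, d x = 0 := by
  classical
  by_contra! hne
  set P := U.filter fun x => 0 < d x with hPdef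
  set N := U.filter fun x => d x < 0 with hNdef
  have hPne : P.Nonempty := by
    obtain ⟨x, hx, hx0⟩ := hne
    obtain ⟨y, hy, hy0⟩ := Finset.exists_pos_of_sum_zero_of_exists_nonzero d h0 ⟨x, hx, hx0⟩
    exact ⟨y, Finset.mem_filter.2 ⟨hy, hy0⟩⟩
  have hNne : N.Nonempty := by
    obtain ⟨x, hx, hx0⟩ := hne
    obtain ⟨y, hy, hy0⟩ := Finset.exists_pos_of_sum_zero_of_exists_nonzero (fun x => -d x)
      (by simpa using h0) ⟨x, hx, by simpa using hx0⟩
    exact ⟨y, Finset.mem_filter.2 ⟨hy, by simpa using hy0⟩⟩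
  obtain ⟨a, ha, hatop⟩ := exists_signVector_top (l := l) hPne (fun x hx y hy =>
    hP x (Finset.mem_filter.1 hx).1 y (Finset.mem_filter.1 hy).1 (Finset.mem_filter.1 hx).2
      (Finset.mem_filter.1 hy).2)
  obtain ⟨b, hb, hbtop⟩ := exists_signVector_top (l := l) hNne (fun x hx y hy =>
    hN x (Finset.mem_filter.1 hx).1 y (Finset.mem_filter.1 hy).1 (Finset.mem_filter.1 hx).2
      (Finset.mem_filter.1 hy).2)
  -- The positive and the negative part have equal total weight and equal weighted sum, so each
  -- functional takes the same value on both. By `signVector_sum` the sign of this value is that of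
  -- the top of either part. Injectivity then identifies the tops, whose coefficients have opposite
  -- signs.
  have hab : signVector l a = signVector l b := by
    funext i
    have hsum : ∑ x ∈ U, d x * l i x = 0 := by
      have := sum_mul_affine U d (fun x => x) (l i)
      rw [this, h0, h1]; simp
    have hsplit : ∑ x ∈ U, d x * l i x = ∑ x ∈ P, d x * l i x - ∑ x ∈ N, (-d x) * l i x := by
      rw [hPdef, hNdef, Finset.sum_filter, Finset.sum_filter, ← Finset.sum_sub_distrib]
      refine Finset.sum_congr rfl fun x _ => ?_
      rcases lt_trichotomy (d x) 0 with h | h | h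
      · rw [if_neg (not_lt.2 h.le), if_pos h]; ring
      · simp [h]
      · rw [if_pos h, if_neg (not_lt.2 h.le)]; ring
    have hPs := signVector_sum (l := l) P d (fun x => x)
      (fun j hj => (Finset.mem_filter.1 hj).2.le) hatop ha rfl (Finset.mem_filter.1 ha).2 i
    have hNs := signVector_sum (l := l) N (fun x => -d x) (fun x => x)
      (fun j hj => by simpa using (Finset.mem_filter.1 hj).2.le) hbtop hb rfl
      (by simpa using (Finset.mem_filter.1 hb).2) i
    rw [← hPs, ← hNs]
    congr 1
    linarith
  have := hinj (Finset.mem_filter.1 ha).1 (Finset.mem_filter.1 hb).1 hab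
  have h2 := (Finset.mem_filter.1 ha).2
  have h3 := (Finset.mem_filter.1 hb).2
  rw [this] at h2
  exact lt_asymm h2 h3

end Triangulation

/-! ### Triangulation of compact semilinear sets -/

section Existence

theorem sum_union_ite_left {J M : Type*} [DecidableEq J] [AddCommMonoid M] {s t : Finset J}
    (g : J → M) : ∑ y ∈ s ∪ t, (if y ∈ s then g y else 0) = ∑ y ∈ s, g y := by
  rw [← Finset.sum_filter, Finset.filter_mem_eq_inter, Finset.union_inter_cancel_left]

theorem sum_union_ite_right {J M : Type*} [DecidableEq J] [AddCommMonoid M] {s t : Finset J}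
    (g : J → M) : ∑ y ∈ s ∪ t, (if y ∈ t then g y else 0) = ∑ y ∈ t, g y := by
  rw [← Finset.sum_filter, Finset.filter_mem_eq_inter, Finset.union_inter_cancel_right]

variable {E : Type*} [NormedAddCommGroup E] [NormedSpace ℝ E] {ι : Type*} {l : ι → E →ᵃ[ℝ] ℝ}

/-- Along the line through two points of one cell a functional is its common sign times the
interpolated absolute value. Going forward, only functionals of decreasing absolute value can
vanish. -/
theorem apply_lineMap_of_sign_eq (f : E →ᵃ[ℝ] ℝ) {b x : E}
    (h : SignType.sign (f b) = SignType.sign (f x)) (t : ℝ) :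
    SignType.sign (f (AffineMap.lineMap b x t)) =
      SignType.sign (f b) * SignType.sign (|f b| + t * (|f x| - |f b|)) := by
  have h1 : f (AffineMap.lineMap b x t) = f b + t * (f x - f b) := by
    rw [AffineMap.apply_lineMap, AffineMap.lineMap_apply_ring']
    ring
  have h2 : f (AffineMap.lineMap b x t) =
      (SignType.sign (f b) : ℝ) * (|f b| + t * (|f x| - |f b|)) := by
    have hb := sign_mul_abs (f b)
    have hx := sign_mul_abs (f x)
    rw [← h] at hx
    rw [h1]
    linear_combination (-(1 - t)) * hb - t * hx
  rw [h2, sign_mul]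
  congr 1
  cases SignType.sign (f b) <;> simp

/-- From a point of a bounded cell one reaches a proper face of the cell by moving away from
a given other point of the cell. -/
theorem exists_proper_face_point [Fintype ι] {A : Set E} (hcl : IsClosed A)
    (hbd : Bornology.IsBounded A)
    (hA : ∀ x y, signVector l x = signVector l y → x ∈ A → y ∈ A)
    {b x : E} (hx : x ∈ A) (hbx : signVector l b = signVector l x) (hne : b ≠ x) :
    ∃ y ∈ A, IsSignFace (signVector l y) (signVector l x) ∧ signVector l y ≠ signVector l x ∧
      x ∈ segment ℝ b y := by
  classical
  have hs : ∀ i, SignType.sign (l i b) = SignType.sign (l i x) := fun i => congrFun hbx i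
  have key : ∀ i t, signVector l (AffineMap.lineMap b x t) i =
      SignType.sign (l i b) * SignType.sign (|l i b| + t * (|l i x| - |l i b|)) :=
    fun i t => apply_lineMap_of_sign_eq (l i) (hs i) t
  -- Only functionals in `D` can vanish on the ray from `b` through `x`; their least vanishing time
  -- `T` is the exit time from the cell.
  set D : Finset ι := Finset.univ.filter fun i => |l i x| < |l i b| with hD
  have hstay : ∀ t : ℝ, 0 ≤ t → (∀ i ∈ D, 0 < |l i b| + t * (|l i x| - |l i b|)) →
      signVector l (AffineMap.lineMap b x t) = signVector l x := by
    intro t ht hpos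
    funext i
    rw [key]
    change _ = SignType.sign (l i x)
    rw [← hs i]
    by_cases h0 : l i b = 0
    · simp [h0]
    · have : 0 < |l i b| + t * (|l i x| - |l i b|) := by
        by_cases hi : i ∈ D
        · exact hpos i hi
        · have h1 : |l i b| ≤ |l i x| := by simpa [hD] using hi
          have h2 : 0 < |l i b| := abs_pos.2 h0
          nlinarith
      rw [sign_pos this, mul_one]
  -- Otherwise the whole ray would stay in the cell, hence in the bounded set `A`.
  have hDne : D.Nonempty := by
    by_contra hD0
    rw [Finset.not_nonempty_iff_eq_empty] at hD0
    have hall : ∀ t : ℝ, 0 ≤ t → AffineMap.lineMap b x t ∈ A := fun t ht =>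
      hA x _ (hstay t ht (by simp [hD0])).symm hx
    obtain ⟨R, hR⟩ := hbd.subset_closedBall b
    have hpos : 0 < ‖x - b‖ := norm_pos_iff.2 (sub_ne_zero.2 hne.symm)
    have hR0 : 0 ≤ R := by
      have := hR (hall 0 le_rfl)
      simpa using this
    have h1 := hR (hall ((R + 1) / ‖x - b‖) (by positivity))
    rw [Metric.mem_closedBall, dist_eq_norm, AffineMap.lineMap_apply, vsub_eq_sub, vadd_eq_add,
      add_sub_cancel_right, norm_smul, Real.norm_of_nonneg (by positivity),
      div_mul_cancel₀ _ hpos.ne'] at h1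
    linarith
  obtain ⟨i₀, hi₀, hmin⟩ := D.exists_min_image (fun i => |l i b| / (|l i b| - |l i x|)) hDne
  set T := |l i₀ b| / (|l i₀ b| - |l i₀ x|) with hT
  have hDlt : ∀ i ∈ D, |l i x| < |l i b| := fun i hi => (Finset.mem_filter.1 hi).2
  have hT1 : 1 < T := by
    have h1 := hDlt i₀ hi₀
    have h2 : 0 < |l i₀ x| := by
      rw [abs_pos]
      intro h0
      have h3 := hs i₀
      rw [h0, sign_zero, sign_eq_zero_iff] at h3
      simp [h0, h3] at h1
    rw [hT, lt_div_iff₀ (by linarith)]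
    linarith
  have hlt : ∀ t : ℝ, 0 ≤ t → t < T → AffineMap.lineMap b x t ∈ A := by
    intro t ht htT
    refine hA x _ (hstay t ht fun i hi => ?_).symm hx
    have h1 := hDlt i hi
    have h2 := htT.trans_le (hmin i hi)
    rw [lt_div_iff₀ (by linarith)] at h2
    linarith
  have hTz : |l i₀ b| + T * (|l i₀ x| - |l i₀ b|) = 0 := by
    have h1 := hDlt i₀ hi₀
    have : |l i₀ b| - |l i₀ x| ≠ 0 := by linarith
    rw [hT]; field_simp; ring
  refine ⟨AffineMap.lineMap b x T, ?_, ?_, ?_, ?_⟩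
  · have hcl' : IsClosed ((fun t : ℝ => (AffineMap.lineMap b x t : E)) ⁻¹' A) :=
      hcl.preimage AffineMap.lineMap_continuous
    have hsub : Set.Ioo 0 T ⊆ (fun t : ℝ => (AffineMap.lineMap b x t : E)) ⁻¹' A :=
      fun t ht => hlt t ht.1.le ht.2
    have := hcl'.closure_subset_iff.2 hsub
    rw [closure_Ioo (by linarith)] at this
    exact this ⟨by linarith, le_rfl⟩
  · intro i
    rw [key]
    change _ ∨ _ = SignType.sign (l i x)
    rw [← hs i]
    by_cases h0 : l i b = 0
    · simp [h0]
    · have : 0 ≤ |l i b| + T * (|l i x| - |l i b|) := by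
        by_cases hi : i ∈ D
        · have h1 := hDlt i hi
          have h2 := hmin i hi
          rw [le_div_iff₀ (by linarith)] at h2
          linarith
        · have h1 : |l i b| ≤ |l i x| := by simpa [hD] using hi
          have h2 : 0 < |l i b| := abs_pos.2 h0
          nlinarith
      rcases this.eq_or_lt with h | h
      · left; rw [← h]; simp
      · right; rw [sign_pos h, mul_one]
  · intro h
    have h1 := congrFun h i₀
    rw [key, hTz, sign_zero, mul_zero] at h1
    have h3 : SignType.sign (l i₀ x) = 0 := h1.symm
    rw [← hs i₀, sign_eq_zero_iff] at h3
    have := hDlt i₀ hi₀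
    rw [h3, abs_zero] at this
    exact absurd (abs_nonneg (l i₀ x)) (not_le.2 this)
  · rw [segment_eq_image_lineMap]
    refine ⟨T⁻¹, ⟨by positivity, inv_le_one_of_one_le₀ hT1.le⟩, ?_⟩
    simp only [AffineMap.lineMap_apply, vsub_eq_sub, vadd_eq_add, add_sub_cancel_right, smul_smul]
    rw [inv_mul_cancel₀ (by positivity), one_smul, sub_add_cancel]

/-- A compact semilinear set is the underlying space of a finite simplicial complex. -/
theorem exists_simplicialComplex_of_isSemilinear {A : Set E} (hA : IsSemilinear A)
    (hcl : IsClosed A) (hbd : Bornology.IsBounded A) :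
    ∃ K : Geometry.SimplicialComplex ℝ E, K.faces.Finite ∧ K.space = A := by
  classical
  obtain ⟨F, hF⟩ := hA
  let l : F → E →ᵃ[ℝ] ℝ := fun f => f.1
  have hA : ∀ x y, signVector l x = signVector l y → x ∈ A → y ∈ A := fun x y h hx =>
    hF x y (fun f hf => congrFun h ⟨f, hf⟩) hx
  -- One representative point for each cell that meets `A`. The simplices are the sets of
  -- representatives whose cells form a chain, as in a barycentric subdivision.
  choose! b hbA hbs using fun κ (hκ : κ ∈ signVector l '' A) => hκ
  set V : Finset E := (Set.toFinite (signVector l '' A)).toFinset.image b with hV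
  have hVA : ∀ v ∈ V, v ∈ A := by
    intro v hv
    obtain ⟨κ, hκ, rfl⟩ := Finset.mem_image.1 hv
    exact hbA κ (by simpa using hκ)
  have hinj : Set.InjOn (signVector l) (V : Set E) := by
    intro v hv w hw h
    obtain ⟨κ, hκ, rfl⟩ := Finset.mem_image.1 hv
    obtain ⟨τ, hτ, rfl⟩ := Finset.mem_image.1 hw
    rw [hbs κ (by simpa using hκ), hbs τ (by simpa using hτ)] at h
    rw [h]
  have hrep : ∀ x ∈ A, ∃ v ∈ V, signVector l v = signVector l x := fun x hx =>
    ⟨b (signVector l x), Finset.mem_image.2 ⟨_, by simpa using ⟨x, hx, rfl⟩, rfl⟩,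
      hbs _ ⟨x, hx, rfl⟩⟩
  let C : Finset E → Prop := fun s => s ⊆ V ∧ ∀ x ∈ s, ∀ y ∈ s,
    IsSignFace (signVector l x) (signVector l y) ∨ IsSignFace (signVector l y) (signVector l x)
  let K : Geometry.SimplicialComplex ℝ E :=
    { faces := {s | s.Nonempty ∧ C s}
      isRelLowerSet_faces := by
        rintro s ⟨hs, hC⟩
        exact ⟨hs, fun t hts ht => ⟨ht, hts.trans hC.1,
          fun x hx y hy => hC.2 x (hts hx) y (hts hy)⟩⟩
      indep := by
        rintro s ⟨-, hsV, hC⟩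
        rw [affineIndependent_iff]
        intro t w hw hwx
        have h := eq_zero_of_chain_relation (l := l) (U := t.map ⟨Subtype.val, Subtype.val_injective⟩)
          (hinj.mono fun x hx => by
            simp only [Finset.coe_map, Function.Embedding.coeFn_mk, Set.mem_image] at hx
            obtain ⟨y, -, rfl⟩ := hx
            exact hsV y.2)
          (fun x => if hx : x ∈ s then w ⟨x, hx⟩ else 0)
          (fun x hx y hy _ _ => hC x (by
              obtain ⟨z, -, rfl⟩ := Finset.mem_map.1 hx; exact z.2) y (by
              obtain ⟨z, -, rfl⟩ := Finset.mem_map.1 hy; exact z.2))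
          (fun x hx y hy _ _ => hC x (by
              obtain ⟨z, -, rfl⟩ := Finset.mem_map.1 hx; exact z.2) y (by
              obtain ⟨z, -, rfl⟩ := Finset.mem_map.1 hy; exact z.2))
          (by rw [Finset.sum_map]; simpa using hw)
          (by rw [Finset.sum_map]; simpa using hwx)
        intro e he
        have := h e (Finset.mem_map.2 ⟨e, he, rfl⟩)
        simpa using this
      inter_subset_convexHull := by
        rintro s t ⟨-, hsV, hs⟩ ⟨-, htV, ht⟩ x ⟨hxs, hxt⟩
        rw [Finset.mem_convexHull'] at hxs hxt
        obtain ⟨w, hw0, hw1, hwx⟩ := hxs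
        obtain ⟨w', hw'0, hw'1, hw'x⟩ := hxt
        have hmemP : ∀ y, 0 < (if y ∈ s then w y else 0) - (if y ∈ t then w' y else 0) →
            y ∈ s := by
          intro y hy
          by_contra hys
          rw [if_neg hys] at hy
          split_ifs at hy with hyt
          · linarith [hw'0 y hyt]
          · linarith
        have hmemN : ∀ y, (if y ∈ s then w y else 0) - (if y ∈ t then w' y else 0) < 0 →
            y ∈ t := by
          intro y hy
          by_contra hyt
          rw [if_neg hyt] at hy
          split_ifs at hy with hys
          · linarith [hw0 y hys]
          · linarith
        -- The difference of the two convex representations of `x` has its positive part supported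
        -- in `s` and its negative part in `t`, so it vanishes, and the weights live on `s ∩ t`.
        have h := eq_zero_of_chain_relation (l := l) (U := s ∪ t)
          (hinj.mono fun y hy => by
            rcases Finset.mem_union.1 hy with hy | hy
            · exact hsV hy
            · exact htV hy)
          (fun y => (if y ∈ s then w y else 0) - (if y ∈ t then w' y else 0))
          (fun y _ z _ hy hz => hs y (hmemP y hy) z (hmemP z hz))
          (fun y _ z _ hy hz => ht y (hmemN y hy) z (hmemN z hz))
          (by rw [Finset.sum_sub_distrib, sum_union_ite_left w, sum_union_ite_right w', hw1, hw'1, sub_self])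
          (by
            simp only [sub_smul, ite_smul, zero_smul]
            rw [Finset.sum_sub_distrib, sum_union_ite_left fun y => w y • y,
              sum_union_ite_right fun y => w' y • y, hwx, hw'x, sub_self])
        have hzero : ∀ y ∈ s, y ∉ s ∩ t → w y = 0 := by
          intro y hys hyn
          have hyt : y ∉ t := fun hyt => hyn (Finset.mem_inter.2 ⟨hys, hyt⟩)
          have := h y (Finset.mem_union_left _ hys)
          simpa [hys, hyt] using this
        rw [← Finset.coe_inter, Finset.mem_convexHull']
        refine ⟨w, fun y hy => hw0 y (Finset.mem_inter.1 hy).1, ?_, ?_⟩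
        · rw [← hw1]
          exact Finset.sum_subset Finset.inter_subset_left hzero
        · rw [← hwx]
          exact Finset.sum_subset Finset.inter_subset_left fun y hy hyn => by
            rw [hzero y hy hyn, zero_smul] }
  refine ⟨K, ?_, ?_⟩
  · exact (Finset.finite_toSet V.powerset).subset fun s hs => Finset.mem_coe.2
      (Finset.mem_powerset.2 hs.2.1)
  · ext x
    rw [Geometry.SimplicialComplex.mem_space_iff]
    constructor
    · rintro ⟨s, ⟨-, hsV, hC⟩, hx⟩
      rw [Finset.mem_convexHull'] at hx
      obtain ⟨w, hw0, hw1, hwx⟩ := hx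
      set s' := s.filter fun y => w y ≠ 0 with hs'
      have hne : s'.Nonempty := by
        by_contra hemp
        rw [Finset.not_nonempty_iff_eq_empty, Finset.filter_eq_empty_iff] at hemp
        rw [Finset.sum_eq_zero fun y hy => not_not.1 (hemp hy)] at hw1
        exact zero_ne_one hw1
      obtain ⟨y, hy, htop⟩ := exists_signVector_top (l := l) hne (fun a ha c hc =>
        hC a (Finset.mem_filter.1 ha).1 c (Finset.mem_filter.1 hc).1)
      have hys := (Finset.mem_filter.1 hy).1
      refine hA y x ?_ (hVA y (hsV hys))
      funext i
      have h1 := signVector_sum (l := l) s' w (fun x => x)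
        (fun j hj => hw0 j (Finset.mem_filter.1 hj).1) htop hy rfl
        ((hw0 y hys).lt_of_ne' (Finset.mem_filter.1 hy).2) i
      have h3 : ∑ j ∈ s', w j * l i j = ∑ j ∈ s, w j * l i j :=
        Finset.sum_filter_of_ne fun j _ hj h0 => hj (by rw [h0, zero_mul])
      rw [← h1, h3]
      have h2 := sum_mul_affine s w (fun x => x) (l i)
      rw [h2, hwx, hw1, one_mul]
      change _ = SignType.sign (l i x)
      congr 1
      have := (l i).map_vadd 0 x
      simpa using this.symm
    · intro hx
      -- Induction on rank: the ray from the representative of the cell through `x` exits at a point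
      -- `y` of a proper face; the simplex found for `y`, coned off from the representative,
      -- contains `x`.
      have hmain : ∀ n : ℕ, ∀ x ∈ A, signRank (signVector l x) = n →
          ∃ s, s.Nonempty ∧ C s ∧ x ∈ convexHull ℝ (s : Set E) ∧
            ∀ y ∈ s, IsSignFace (signVector l y) (signVector l x) := by
        intro n
        induction n using Nat.strong_induction_on with
        | _ n ih =>
        intro x hx hn
        obtain ⟨v, hv, hvx⟩ := hrep x hx
        by_cases hvx' : v = x
        · refine ⟨{v}, Finset.singleton_nonempty v, ⟨by simpa using hv, ?_⟩, by simp [hvx'], ?_⟩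
          · intro a ha c hc
            rw [Finset.mem_singleton.1 ha, Finset.mem_singleton.1 hc]
            exact Or.inl (IsSignFace.refl _)
          · intro a ha
            rw [Finset.mem_singleton.1 ha, hvx]
            exact IsSignFace.refl _
        · obtain ⟨y, hyA, hface, hyne, hseg⟩ :=
            exists_proper_face_point hcl hbd hA hx hvx hvx'
          have hlt : signRank (signVector l y) < n := by
            rw [← hn]
            by_contra hle
            exact hyne (hface.eq_of_rank_le (not_lt.1 hle))
          obtain ⟨s, -, hsC, hys, htop⟩ := ih _ hlt y hyA rfl
          have htop' : ∀ z ∈ s, IsSignFace (signVector l z) (signVector l x) :=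
            fun z hz => (htop z hz).trans hface
          refine ⟨insert v s, Finset.insert_nonempty v s, ⟨?_, ?_⟩, ?_, ?_⟩
          · exact Finset.insert_subset hv hsC.1
          · intro a ha c hc
            rcases Finset.mem_insert.1 ha with ha' | ha'
            · right
              rw [ha', hvx]
              rcases Finset.mem_insert.1 hc with hc' | hc'
              · rw [hc', hvx]; exact IsSignFace.refl _
              · exact htop' c hc'
            · rcases Finset.mem_insert.1 hc with hc' | hc'
              · left; rw [hc', hvx]; exact htop' a ha'
              · exact hsC.2 a ha' c hc'
          · refine (convex_convexHull ℝ _).segment_subset (subset_convexHull ℝ _ ?_)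
              (convexHull_mono ?_ hys) hseg
            · simp
            · simp
          · intro z hz
            rcases Finset.mem_insert.1 hz with rfl | hz
            · rw [hvx]; exact IsSignFace.refl _
            · exact htop' z hz
      obtain ⟨s, hs, hC, hxs, -⟩ := hmain _ x hx rfl
      exact ⟨s, ⟨hs, hC⟩, hxs⟩

end Existence

/-! ### Combs: sets of vertices closed under parents -/

section Comb

variable {d : ℕ}

/-- `w` is the parent of `v`: the last nonzero coordinate of `v` is moved one step towards zero. -/
def IsParent (v w : Fin d → ℤ) : Prop :=
  ∃ k, v k ≠ 0 ∧ (∀ i, k < i → v i = 0) ∧ w = Function.update v k (v k - (v k).sign)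

/-- A set of vertices that contains the origin and the parents of its elements. -/
structure IsComb (H : Finset (Fin d → ℤ)) : Prop where
  zero_mem : 0 ∈ H
  parent_mem : ∀ v ∈ H, ∀ w, IsParent v w → w ∈ H

/-- The vector that keeps the first `n` coordinates and has zeros afterwards. -/
def truncate {R : Type*} [Zero R] (n : ℕ) (v : Fin d → R) : Fin d → R :=
  fun i => if i.val < n then v i else 0

theorem truncate_eq_self {R : Type*} [Zero R] {n : ℕ} {v : Fin d → R}
    (h : ∀ i : Fin d, n ≤ i.val → v i = 0) : truncate n v = v := by
  funext i
  unfold truncate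
  split_ifs with hi
  · rfl
  · exact (h i (not_lt.1 hi)).symm

theorem truncate_zero {R : Type*} [Zero R] (v : Fin d → R) : truncate 0 v = 0 := by
  funext i; simp [truncate]

theorem truncate_dim {R : Type*} [Zero R] (v : Fin d → R) : truncate d v = v :=
  truncate_eq_self fun i hi => absurd i.2 (not_lt.2 hi)

theorem truncate_congr {R : Type*} [Zero R] {n : ℕ} {v w : Fin d → R}
    (h : ∀ i : Fin d, i.val < n → v i = w i) : truncate n v = truncate n w := by
  funext i
  simp only [truncate]
  split_ifs with h1
  · exact h i h1
  · rfl

/-- Passing to parents lowers the last nonzero coordinate step by step; `ε` is its sign and `n` the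
number of steps. -/
theorem IsComb.update_mem {H : Finset (Fin d → ℤ)} (hH : IsComb H) {k : Fin d} (ε : ℤˣ) {t : ℤ}
    (ht : 0 ≤ ε * t) (n : ℕ) : ∀ v ∈ H, (∀ i, k < i → v i = 0) → v k = t + ε * n →
    Function.update v k t ∈ H := by
  induction n with
  | zero =>
    intro v hv _ hk
    have : t = v k := by simpa using hk.symm
    rwa [this, Function.update_eq_self]
  | succ n ih =>
    intro v hv h0 hk
    have hsign : (v k).sign = ε := by
      rcases Int.units_eq_one_or ε with rfl | rfl
      · rw [Int.sign_eq_one_of_pos]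
        · rfl
        · simp at ht hk; omega
      · rw [Int.sign_eq_neg_one_of_neg]
        · rfl
        · simp at ht hk; omega
    have hp := hH.parent_mem v hv _ ⟨k, by
      intro h
      rw [h] at hsign
      rcases Int.units_eq_one_or ε with rfl | rfl <;> simp at hsign, h0, rfl⟩
    have := ih _ hp (fun i hi => by rw [Function.update_of_ne hi.ne']; exact h0 i hi)
      (by rw [Function.update_self, hsign, hk]; push_cast; ring)
    rwa [Function.update_idem] at this

theorem IsComb.truncate_mem {H : Finset (Fin d → ℤ)} (hH : IsComb H) {v : Fin d → ℤ} (hv : v ∈ H)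
    (n : ℕ) : truncate n v ∈ H := by
  by_cases hn : d ≤ n
  · rwa [truncate_eq_self fun i hi => absurd i.2 (by omega)]
  · have hmain : ∀ m ≤ d, truncate (d - m) v ∈ H := by
      intro m
      induction m with
      | zero => intro _; rwa [Nat.sub_zero, truncate_dim]
      | succ m ih =>
        intro hm
        have h1 := ih (by omega)
        let k : Fin d := ⟨d - (m + 1), by omega⟩
        have hk : ∀ i, k < i → truncate (d - m) v i = 0 := by
          intro i hi
          have : d - (m + 1) < i.val := hi
          simp only [truncate]
          rw [if_neg (by omega)]
        have heq : truncate (d - (m + 1)) v = Function.update (truncate (d - m) v) k 0 := by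
          funext i
          by_cases hi : i = k
          · rw [hi, Function.update_self]
            simp [truncate, k]
          · rw [Function.update_of_ne hi]
            simp only [truncate]
            have : i.val ≠ d - (m + 1) := fun h => hi (Fin.ext h)
            split_ifs <;> first | rfl | omega
        rw [heq]
        rcases le_total 0 (truncate (d - m) v k) with h | h
        · exact hH.update_mem 1 (by simp) (truncate (d - m) v k).toNat _ h1 hk (by simp [h])
        · exact hH.update_mem (-1) (by simp) (-truncate (d - m) v k).toNat _ h1 hk (by
            rw [Int.toNat_of_nonneg (by omega)]; simp)
    have := hmain (d - n) (by omega)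
    rwa [Nat.sub_sub_self (by omega)] at this

end Comb

/-! ### Height functions of the region around a comb -/

noncomputable section Height

variable {d : ℕ}

/-- The plateau function around `v` in the coordinates before `k`: it is one up to distance `1/2`
and zero from distance `1` on. -/
def bump (k : Fin d) (v : Fin d → ℤ) (x : Fin d → ℝ) : ℝ :=
  max 0 (min 1 (2 + 2 * -‖fun i => if i < k then -(v i : ℝ) + x i else 0‖))

/-- The contribution of the vertex `v` to the height function in direction `ε e_k`. -/
def spike (ε : ℤˣ) (k : Fin d) (v : Fin d → ℤ) (x : Fin d → ℝ) : ℝ :=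
  (if ∀ i, k < i → v i = 0 then ((max 0 (ε * v k) : ℤ) : ℝ) else 0) * bump k v x

/-- The height in direction `ε e_k` of the region around `H`. It depends on the coordinates
before `k` only. -/
def height (H : Finset (Fin d → ℤ)) (ε : ℤˣ) (k : Fin d) (x : Fin d → ℝ) : ℝ :=
  1 / 2 + ‖fun v : H => spike ε k v x‖

theorem bump_nonneg (k : Fin d) (v : Fin d → ℤ) (x : Fin d → ℝ) : 0 ≤ bump k v x :=
  le_max_left _ _

theorem bump_le_one (k : Fin d) (v : Fin d → ℤ) (x : Fin d → ℝ) : bump k v x ≤ 1 :=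
  max_le zero_le_one (min_le_left _ _)

theorem bump_eq_one {k : Fin d} {v : Fin d → ℤ} {x : Fin d → ℝ}
    (h : ∀ i < k, |x i - v i| ≤ 1 / 2) : bump k v x = 1 := by
  have : ‖fun i => if i < k then -(v i : ℝ) + x i else 0‖ ≤ 1 / 2 := by
    rw [pi_norm_le_iff_of_nonneg (by norm_num)]
    intro i
    split_ifs with hi
    · rw [Real.norm_eq_abs, neg_add_eq_sub]; exact h i hi
    · simp
  unfold bump
  rw [min_eq_left (by linarith), max_eq_right zero_le_one]

theorem abs_lt_one_of_bump_ne_zero {k : Fin d} {v : Fin d → ℤ} {x : Fin d → ℝ}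
    (h : bump k v x ≠ 0) : ∀ i < k, |x i - v i| < 1 := by
  intro i hi
  by_contra hc
  apply h
  have h1 := norm_le_pi_norm (fun i => if i < k then -(v i : ℝ) + x i else 0) i
  simp only [if_pos hi, Real.norm_eq_abs, neg_add_eq_sub] at h1
  unfold bump
  apply max_eq_left
  refine (min_le_right _ _).trans ?_
  push Not at hc
  have h2 : ‖fun i => if i < k then -(v i : ℝ) + x i else 0‖ =
    ‖fun i => if i < k then x i - (v i : ℝ) else 0‖ := by simp only [neg_add_eq_sub]
  linarith

theorem spike_nonneg (ε : ℤˣ) (k : Fin d) (v : Fin d → ℤ) (x : Fin d → ℝ) : 0 ≤ spike ε k v x := by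
  unfold spike
  refine mul_nonneg ?_ (bump_nonneg _ _ _)
  split_ifs
  · exact_mod_cast le_max_left _ _
  · exact le_rfl

theorem spike_le_of_bump_le {ε : ℤˣ} {k : Fin d} {v : Fin d → ℤ} {x y : Fin d → ℝ}
    (h : bump k v x ≤ bump k v y) : spike ε k v x ≤ spike ε k v y := by
  unfold spike
  refine mul_le_mul_of_nonneg_left h ?_
  split_ifs
  · exact_mod_cast le_max_left _ _
  · exact le_rfl

/-- Spikes are nonnegative, so the sup norm in the height is simply their maximum over `H`. -/
theorem le_height_iff {H : Finset (Fin d → ℤ)} {ε : ℤˣ} {k : Fin d} {x : Fin d → ℝ} {a : ℝ} :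
    a ≤ height H ε k x ↔ a ≤ 1 / 2 ∨ ∃ v ∈ H, a ≤ 1 / 2 + spike ε k v x := by
  unfold height
  constructor
  · intro h
    by_contra! hc
    have := (pi_norm_lt_iff (x := fun v : H => spike ε k v x) (r := a - 1 / 2)
      (by linarith)).2 (fun v => by
        rw [Real.norm_of_nonneg (spike_nonneg _ _ _ _)]
        linarith [hc.2 v v.2])
    linarith
  · rintro (h | ⟨v, hv, h⟩)
    · linarith [norm_nonneg fun v : H => spike ε k v x]
    · have := norm_le_pi_norm (fun v : H => spike ε k v x) ⟨v, hv⟩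
      rw [Real.norm_of_nonneg (spike_nonneg _ _ _ _)] at this
      simp only at this
      linarith

theorem half_le_height (H : Finset (Fin d → ℤ)) (ε : ℤˣ) (k : Fin d) (x : Fin d → ℝ) :
    1 / 2 ≤ height H ε k x :=
  le_height_iff.2 (Or.inl le_rfl)

theorem height_pos (H : Finset (Fin d → ℤ)) (ε : ℤˣ) (k : Fin d) (x : Fin d → ℝ) :
    0 < height H ε k x :=
  lt_of_lt_of_le (by norm_num) (half_le_height H ε k x)

theorem bump_congr {k : Fin d} {v : Fin d → ℤ} {x y : Fin d → ℝ} (h : ∀ i < k, x i = y i) :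
    bump k v x = bump k v y := by
  have : (fun i => if i < k then -(v i : ℝ) + x i else 0) =
      fun i => if i < k then -(v i : ℝ) + y i else 0 := by
    funext i
    split_ifs with hi
    · rw [h i hi]
    · rfl
  unfold bump
  rw [this]

theorem height_congr {H : Finset (Fin d → ℤ)} {ε : ℤˣ} {k : Fin d} {x y : Fin d → ℝ}
    (h : ∀ i < k, x i = y i) : height H ε k x = height H ε k y := by
  unfold height spike
  simp only [bump_congr h]

theorem continuous_bump (k : Fin d) (v : Fin d → ℤ) : Continuous (bump k v) := by
  unfold bump
  refine continuous_const.max (continuous_const.min (continuous_const.add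
    (continuous_const.mul (Continuous.neg (Continuous.norm (continuous_pi fun i => ?_))))))
  split_ifs <;> fun_prop

theorem continuous_height (H : Finset (Fin d → ℤ)) (ε : ℤˣ) (k : Fin d) :
    Continuous (height H ε k) := by
  unfold height spike
  exact continuous_const.add (Continuous.norm (continuous_pi fun v =>
    continuous_const.mul (continuous_bump k _)))

/-- The affine functional `x ↦ x i` on Euclidean space. -/
def coordAffine (i : Fin d) : EuclideanSpace ℝ (Fin d) →ᵃ[ℝ] ℝ :=
  (EuclideanSpace.proj (𝕜 := ℝ) i).toLinearMap.toAffineMap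

theorem coordAffine_apply (i : Fin d) (x : EuclideanSpace ℝ (Fin d)) : coordAffine i x = x i := rfl

theorem isPiecewiseLinear_height (H : Finset (Fin d → ℤ)) (ε : ℤˣ) (k : Fin d) :
    IsPiecewiseLinear fun x : EuclideanSpace ℝ (Fin d) => height H ε k x := by
  -- The shapes `-(v i) + x i` and `2 + 2 * -‖…‖` in the definition of `bump` are chosen to match
  -- the closure lemmas applied here.
  unfold height spike bump
  refine (IsPiecewiseLinear.pi_norm fun v => IsPiecewiseLinear.const_mul ?_ ?_).const_add _
  · refine (isPiecewiseLinear_const 0).max ((isPiecewiseLinear_const 1).min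
      (((IsPiecewiseLinear.pi_norm fun i => ?_).neg.const_mul (by norm_num)).const_add _))
    split_ifs with hi
    · exact (isPiecewiseLinear_affine (coordAffine i)).const_add _
    · exact isPiecewiseLinear_const 0
  · split_ifs
    · exact_mod_cast le_max_left _ _
    · exact le_rfl

end Height

/-! ### Lattice points and edges versus the region -/

section Lattice

variable {d : ℕ} {H : Finset (Fin d → ℤ)}

theorem int_eq_of_abs_sub_lt_one {a b : ℤ} (h : |(a : ℝ) - b| < 1) : a = b := by
  have h1 : |a - b| < 1 := by exact_mod_cast h
  rw [Int.abs_lt_one_iff] at h1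
  omega

/-- At lattice points a plateau function is zero or one, as it vanishes from distance one on. -/
theorem spike_intCast (ε : ℤˣ) (k : Fin d) (v u : Fin d → ℤ) :
    spike ε k v (fun i => (u i : ℝ)) =
      (if (∀ i, k < i → v i = 0) ∧ ∀ i < k, u i = v i then max 0 (ε * v k) else 0 : ℤ) := by
  unfold spike
  by_cases h : ∀ i < k, u i = v i
  · rw [bump_eq_one fun i hi => by rw [h i hi]; simp, mul_one]
    by_cases h' : ∀ i, k < i → v i = 0
    · rw [if_pos h', if_pos ⟨h', h⟩]
    · rw [if_neg h', if_neg fun hc => h' hc.1, Int.cast_zero]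
  · have : bump k v (fun i => (u i : ℝ)) = 0 := by
      by_contra hb
      exact h fun i hi => int_eq_of_abs_sub_lt_one (abs_lt_one_of_bump_ne_zero hb i hi)
    rw [this, mul_zero, if_neg fun hc => h hc.2, Int.cast_zero]

/-- Heights at lattice points are integers plus `1 / 2`. This gap keeps the surface away from `ℤ^d`.
-/
theorem add_half_le_height_intCast {ε : ℤˣ} {k : Fin d} {u : Fin d → ℤ} {a : ℤ}
    (h : (a : ℝ) ≤ height H ε k fun i => (u i : ℝ)) :
    (a : ℝ) + 1 / 2 ≤ height H ε k fun i => (u i : ℝ) := by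
  have hround : ∀ b : ℤ, (a : ℝ) ≤ 1 / 2 + b → (a : ℝ) + 1 / 2 ≤ 1 / 2 + b := by
    intro b hb
    have : (a : ℝ) < (b + 1 : ℤ) := by push_cast; linarith
    have : a < b + 1 := by exact_mod_cast this
    have : (a : ℝ) ≤ b := by exact_mod_cast Int.lt_add_one_iff.1 this
    linarith
  rw [le_height_iff] at h ⊢
  rcases h with h | ⟨v, hv, h⟩
  · left
    have := hround 0 (by simpa using h)
    simpa using this
  · right
    refine ⟨v, hv, ?_⟩
    rw [spike_intCast] at h ⊢
    exact hround _ h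

/-- A spike reaching the level `u k > 0` (in direction `ε`) comes from a vertex of `H` in the same
column, which parents lower to the truncation of `u`. -/
theorem intCast_le_height_iff (hH : IsComb H) {ε : ℤˣ} {k : Fin d} {u : Fin d → ℤ} :
    ((ε * u k : ℤ) : ℝ) ≤ height H ε k (fun i => (u i : ℝ)) ↔
      ε * u k ≤ 0 ∨ truncate (k.val + 1) u ∈ H := by
  constructor
  · intro h
    by_contra! hc
    have hpos : (1 : ℝ) ≤ (ε * u k : ℤ) := by exact_mod_cast hc.1
    rw [le_height_iff] at h
    rcases h with h | ⟨v, hv, h⟩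
    · linarith
    rw [spike_intCast] at h
    split_ifs at h with hif
    · have h1 : ((ε * u k : ℤ) : ℝ) < (max 0 (ε * v k) + 1 : ℤ) := by push_cast at h ⊢; linarith
      have h2 : (ε : ℤ) * u k < max 0 (ε * v k) + 1 := by exact_mod_cast h1
      have h3 : (ε : ℤ) * u k ≤ ε * v k := by omega
      apply hc.2
      have h4 := hH.update_mem (k := k) ε (t := u k) hc.1.le (ε * v k - ε * u k).toNat v hv hif.1
        (by
          rw [Int.toNat_of_nonneg (by omega), mul_sub, ← mul_assoc, ← mul_assoc]
          simp)
      convert h4 using 1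
      funext i
      by_cases hi : i = k
      · rw [hi]; simp [truncate]
      · rw [Function.update_of_ne hi]
        rcases lt_or_gt_of_ne hi with hlt | hlt
        · have : i.val < k.val := hlt
          simp only [truncate]
          rw [if_pos (by omega), hif.2 i hlt]
        · have : k.val < i.val := hlt
          simp only [truncate]
          rw [if_neg (by omega), hif.1 i hlt]
    · rw [Int.cast_zero] at h
      linarith
  · rw [le_height_iff]
    rintro (h | h)
    · left
      have : ((ε * u k : ℤ) : ℝ) ≤ 0 := by exact_mod_cast h
      linarith
    · right
      refine ⟨_, h, ?_⟩
      rw [spike_intCast, if_pos]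
      · have : ((ε * u k : ℤ) : ℝ) ≤ (max 0 (ε * truncate (k.val + 1) u k) : ℤ) := by
          simp [truncate]
        linarith
      · constructor
        · intro i hi
          have : k.val < i.val := hi
          simp only [truncate]
          rw [if_neg (by omega)]
        · intro i hi
          have : i.val < k.val := hi
          simp only [truncate]
          rw [if_pos (by omega)]

/-- Once `u` has left the comb at coordinate `m`, no later spike rises over it: the vertex of such a
spike agrees with `u` up to `m`, and its truncation would lie in `H`. -/
theorem height_le_half_of_truncate_notMem (hH : IsComb H) {ε : ℤˣ} {m k : Fin d} (hmk : m < k)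
    {u : Fin d → ℤ} (hu : truncate (m.val + 1) u ∉ H) :
    height H ε k (fun i => (u i : ℝ)) ≤ 1 / 2 := by
  by_contra! hc
  rcases le_height_iff.1 (le_refl (height H ε k fun i => (u i : ℝ))) with h | ⟨v, hv, h⟩
  · linarith
  · rw [spike_intCast] at h
    split_ifs at h with hif
    · apply hu
      have h1 := hH.truncate_mem hv (m.val + 1)
      convert h1 using 1
      refine truncate_congr fun i hi => hif.2 i ?_
      have : m.val < k.val := hmk
      exact Fin.lt_def.2 (by omega)
    · rw [Int.cast_zero] at h
      linarith

/-- The coordinate `k` of `x` is within the heights of the region around `H`. -/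
def Within (H : Finset (Fin d → ℤ)) (k : Fin d) (x : Fin d → ℝ) : Prop :=
  ∀ ε : ℤˣ, ((ε : ℤ) : ℝ) * x k ≤ height H ε k x

theorem exists_unit_mul_pos {a : ℤ} (ha : a ≠ 0) : ∃ ε : ℤˣ, 0 < ε * a := by
  rcases lt_or_gt_of_ne ha with h | h
  · exact ⟨-1, by simpa using h⟩
  · exact ⟨1, by simpa using h⟩

theorem within_intCast_iff (hH : IsComb H) {k : Fin d} {u : Fin d → ℤ} :
    Within H k (fun i => (u i : ℝ)) ↔ u k = 0 ∨ truncate (k.val + 1) u ∈ H := by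
  have hcast : ∀ ε : ℤˣ, ((ε : ℤ) : ℝ) * (u k : ℝ) = ((ε * u k : ℤ) : ℝ) := fun ε => by push_cast; rfl
  constructor
  · intro h
    by_cases h0 : u k = 0
    · exact Or.inl h0
    · obtain ⟨ε, hε⟩ := exists_unit_mul_pos h0
      have := h ε
      rw [hcast, intCast_le_height_iff hH] at this
      exact Or.inr (this.resolve_left (not_le.2 hε))
  · intro h ε
    rw [hcast, intCast_le_height_iff hH]
    rcases h with h | h
    · left; rw [h, mul_zero]
    · exact Or.inr h

/-- So the lattice points of the region are those of `H`. For the converse, truncations are extended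
one coordinate at a time; a zero coordinate changes nothing. -/
theorem mem_iff_forall_within (hH : IsComb H) {u : Fin d → ℤ} :
    u ∈ H ↔ ∀ k, Within H k (fun i => (u i : ℝ)) := by
  constructor
  · exact fun hu k => (within_intCast_iff hH).2 (Or.inr (hH.truncate_mem hu _))
  · intro h
    have hmain : ∀ n ≤ d, truncate n u ∈ H := by
      intro n
      induction n with
      | zero => intro _; rw [truncate_zero]; exact hH.zero_mem
      | succ n ih =>
        intro hn
        rcases (within_intCast_iff hH).1 (h ⟨n, by omega⟩) with h0 | h0
        · convert ih (by omega) using 1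
          funext i
          simp only [truncate]
          by_cases hi : i.val = n
          · have : i = ⟨n, by omega⟩ := Fin.ext hi
            rw [if_pos (by omega), if_neg (by omega), this, h0]
          · split_ifs <;> first | rfl | omega
        · exact h0
    have := hmain d le_rfl
    rwa [truncate_dim] at this

/-- `x` is a point of the bond in direction `j` between the neighbours `v` and `w`. -/
structure OnEdge (j : Fin d) (v w : Fin d → ℤ) (x : Fin d → ℝ) : Prop where
  eq_of_ne : ∀ i, i ≠ j → v i = w i ∧ x i = v i
  adj : |v j - w j| = 1
  mem : ∃ t : ℝ, 0 ≤ t ∧ t ≤ 1 ∧ x j = (1 - t) * v j + t * w j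

theorem OnEdge.symm {j : Fin d} {v w : Fin d → ℤ} {x : Fin d → ℝ} (h : OnEdge j v w x) :
    OnEdge j w v x where
  eq_of_ne i hi := ⟨(h.eq_of_ne i hi).1.symm, by
    rw [(h.eq_of_ne i hi).2, (h.eq_of_ne i hi).1]⟩
  adj := by rw [abs_sub_comm]; exact h.adj
  mem := by
    obtain ⟨t, h0, h1, h⟩ := h.mem
    exact ⟨1 - t, by linarith, by linarith, by rw [h]; ring⟩

theorem OnEdge.height_eq {j : Fin d} {v w : Fin d → ℤ} {x : Fin d → ℝ} (h : OnEdge j v w x)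
    {ε : ℤˣ} {k : Fin d} (hk : k ≤ j) : height H ε k x = height H ε k fun i => (v i : ℝ) :=
  height_congr fun i hi => (h.eq_of_ne i (hi.trans_le hk).ne).2

/-- A plateau function that is nonzero at `x` is centred at distance less than one in each earlier
coordinate, and the only integers that close to a point of a unit edge are its ends. -/
theorem OnEdge.bump_le {j : Fin d} {v w : Fin d → ℤ} {x : Fin d → ℝ} (h : OnEdge j v w x)
    {k : Fin d} (u : Fin d → ℤ) (hx : bump k u x ≠ 0) :
    bump k u (fun i => (v i : ℝ)) = 1 ∨ bump k u (fun i => (w i : ℝ)) = 1 := by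
  have h1 := abs_lt_one_of_bump_ne_zero hx
  have hne : ∀ i < k, i ≠ j → v i = u i := fun i hi hij => by
    have := h1 i hi
    rw [(h.eq_of_ne i hij).2] at this
    exact int_eq_of_abs_sub_lt_one this
  have hj : j < k → v j = u j ∨ w j = u j := by
    intro hjk
    have h2 := h1 j hjk
    obtain ⟨t, ht0, ht1, ht⟩ := h.mem
    rw [ht, abs_lt] at h2
    rcases (abs_eq (zero_le_one)).1 h.adj with hadj | hadj
    · have hv : (v j : ℝ) = w j + 1 := by exact_mod_cast (by omega : v j = w j + 1)
      have h3 : ((w j : ℤ) : ℝ) < (u j + 1 : ℤ) := by push_cast; nlinarith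
      have h4 : ((u j : ℤ) : ℝ) < (w j + 2 : ℤ) := by push_cast; nlinarith
      have h3 : w j < u j + 1 := by exact_mod_cast h3
      have h4 : u j < w j + 2 := by exact_mod_cast h4
      omega
    · have hv : (w j : ℝ) = v j + 1 := by exact_mod_cast (by omega : w j = v j + 1)
      have h3 : ((v j : ℤ) : ℝ) < (u j + 1 : ℤ) := by push_cast; nlinarith
      have h4 : ((u j : ℤ) : ℝ) < (v j + 2 : ℤ) := by push_cast; nlinarith
      have h3 : v j < u j + 1 := by exact_mod_cast h3
      have h4 : u j < v j + 2 := by exact_mod_cast h4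
      omega
  by_cases hjk : j < k
  · rcases hj hjk with hj | hj
    · left
      refine bump_eq_one fun i hi => ?_
      have : v i = u i := by
        by_cases hij : i = j
        · rw [hij, hj]
        · exact hne i hi hij
      simp [this]
    · right
      refine bump_eq_one fun i hi => ?_
      have : w i = u i := by
        by_cases hij : i = j
        · rw [hij, hj]
        · rw [← (h.eq_of_ne i hij).1]; exact hne i hi hij
      simp [this]
  · left
    refine bump_eq_one fun i hi => ?_
    have : v i = u i := hne i hi (fun hij => hjk (hij ▸ hi))
    simp [this]

theorem OnEdge.height_le_max {j : Fin d} {v w : Fin d → ℤ} {x : Fin d → ℝ} (h : OnEdge j v w x)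
    (ε : ℤˣ) (k : Fin d) : height H ε k x ≤
      max (height H ε k fun i => (v i : ℝ)) (height H ε k fun i => (w i : ℝ)) := by
  rcases le_height_iff.1 (le_refl (height H ε k x)) with h1 | ⟨u, hu, h1⟩
  · exact le_max_of_le_left (h1.trans (half_le_height _ _ _ _))
  · by_cases hb : bump k u x = 0
    · apply le_max_of_le_left
      have : spike ε k u x = 0 := by unfold spike; rw [hb, mul_zero]
      rw [this, add_zero] at h1
      exact h1.trans (half_le_height _ _ _ _)
    · rcases h.bump_le u hb with h2 | h2
      · refine le_max_of_le_left (le_height_iff.2 (Or.inr ⟨u, hu, h1.trans ?_⟩))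
        have := spike_le_of_bump_le (ε := ε) ((bump_le_one k u x).trans h2.ge)
        linarith
      · refine le_max_of_le_right (le_height_iff.2 (Or.inr ⟨u, hu, h1.trans ?_⟩))
        have := spike_le_of_bump_le (ε := ε) ((bump_le_one k u x).trans h2.ge)
        linarith

/-- This is the purpose of the plateau of radius `1 / 2`: a spike present at `v` keeps its full
height up to the middle of the edge. -/
theorem OnEdge.height_le_of_near {j : Fin d} {v w : Fin d → ℤ} {x : Fin d → ℝ}
    (h : OnEdge j v w x) (hx : |x j - v j| ≤ 1 / 2) (ε : ℤˣ) (k : Fin d) :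
    (height H ε k fun i => (v i : ℝ)) ≤ height H ε k x := by
  rcases le_height_iff.1 (le_refl (height H ε k fun i => (v i : ℝ))) with h1 | ⟨u, hu, h1⟩
  · exact h1.trans (half_le_height _ _ _ _)
  · refine le_height_iff.2 (Or.inr ⟨u, hu, h1.trans ?_⟩)
    have : bump k u (fun i => (v i : ℝ)) ≤ bump k u x := by
      by_cases hb : bump k u (fun i => (v i : ℝ)) = 0
      · rw [hb]; exact bump_nonneg _ _ _
      · have h2 := abs_lt_one_of_bump_ne_zero hb
        rw [bump_eq_one (x := x) fun i hi => ?_]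
        · exact bump_le_one _ _ _
        · have h3 : v i = u i := int_eq_of_abs_sub_lt_one (h2 i hi)
          by_cases hij : i = j
          · rw [← h3, hij]; exact hx
          · rw [(h.eq_of_ne i hij).2, h3]; simp
    have := spike_le_of_bump_le (ε := ε) this
    linarith

theorem OnEdge.min_le_height {j : Fin d} {v w : Fin d → ℤ} {x : Fin d → ℝ} (h : OnEdge j v w x)
    (ε : ℤˣ) (k : Fin d) :
    min (height H ε k fun i => (v i : ℝ)) (height H ε k fun i => (w i : ℝ)) ≤ height H ε k x := by
  obtain ⟨t, ht0, ht1, ht⟩ := h.mem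
  have hadj : |(v j : ℝ) - w j| = 1 := by exact_mod_cast h.adj
  rcases le_total t (1 / 2) with h2 | h2
  · refine (min_le_left _ _).trans (h.height_le_of_near ?_ ε k)
    rw [ht, show (1 - t) * (v j : ℝ) + t * w j - v j = -(t * (v j - w j)) by ring, abs_neg, abs_mul,
      hadj, abs_of_nonneg ht0, mul_one]
    exact h2
  · refine (min_le_right _ _).trans (h.symm.height_le_of_near ?_ ε k)
    rw [ht, show (1 - t) * (v j : ℝ) + t * w j - w j = (1 - t) * (v j - w j) by ring, abs_mul,
      hadj, abs_of_nonneg (by linarith), mul_one]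
    linarith

/-- If `m` is the first coordinate in which an end of an edge leaves the region and `v` leaves
there, then the region contains the other end. -/
theorem OnEdge.mem_of_not_within (hH : IsComb H) {j : Fin d} {v w : Fin d → ℤ} {x : Fin d → ℝ}
    (h : OnEdge j v w x) (hx : ∀ k, Within H k x) {m : Fin d} (hjm : j ≤ m)
    (hlt : ∀ k < m, Within H k fun i => (w i : ℝ)) (hv : ¬ Within H m fun i => (v i : ℝ))
    (hw : Within H m fun i => (w i : ℝ)) : v ∉ H ∧ w ∈ H := by
  refine ⟨fun hvH => hv ((mem_iff_forall_within hH).1 hvH m), ?_⟩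
  rw [mem_iff_forall_within hH]
  intro k
  rcases lt_trichotomy k m with hk | rfl | hk
  · exact hlt k hk
  · exact hw
  · intro ε
    rw [within_intCast_iff hH] at hv
    push Not at hv
    -- Beyond `m` the height over `v` is only `1 / 2`, so the height over `x` is at most that over
    -- `w`; and `x` and `w` share the coordinate `k`, because `k ≠ j`.
    have h1 := h.height_le_max (H := H) ε k
    have h2 := height_le_half_of_truncate_notMem hH (ε := ε) hk hv.2
    rw [max_eq_right (h2.trans (half_le_height _ _ _ _))] at h1
    have hne := h.eq_of_ne k (hjm.trans_lt hk).ne'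
    refine le_trans ?_ ((hx k ε).trans h1)
    rw [hne.2, hne.1]

/-- An edge that contains a point of the boundary of the region joins a vertex of `H` to
a vertex outside. -/
theorem OnEdge.mem_xor (hH : IsComb H) {j : Fin d} {v w : Fin d → ℤ} {x : Fin d → ℝ}
    (h : OnEdge j v w x) (hx : ∀ k, Within H k x)
    (hbd : ∃ k, ∃ ε : ℤˣ, height H ε k x ≤ ((ε : ℤ) : ℝ) * x k) :
    v ∈ H ∧ w ∉ H ∨ v ∉ H ∧ w ∈ H := by
  have hxj : ∀ ε : ℤˣ, ((ε : ℤ) : ℝ) * x j ≤ max (((ε : ℤ) : ℝ) * v j) (((ε : ℤ) : ℝ) * w j) ∧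
      min (((ε : ℤ) : ℝ) * v j) (((ε : ℤ) : ℝ) * w j) ≤ ((ε : ℤ) : ℝ) * x j := by
    intro ε
    obtain ⟨t, ht0, ht1, ht⟩ := h.mem
    have : ((ε : ℤ) : ℝ) * x j = (1 - t) * (((ε : ℤ) : ℝ) * v j) + t * (((ε : ℤ) : ℝ) * w j) := by
      rw [ht]; ring
    rw [this]
    rcases le_total (((ε : ℤ) : ℝ) * v j) (((ε : ℤ) : ℝ) * w j) with h1 | h1
    · rw [max_eq_right h1, min_eq_left h1]
      constructor <;> nlinarith
    · rw [max_eq_left h1, min_eq_right h1]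
      constructor <;> nlinarith
  have hgap : ∀ {u : Fin d → ℤ}, u ∈ H → ∀ k (ε : ℤˣ),
      ((ε : ℤ) : ℝ) * u k < height H ε k fun i => (u i : ℝ) := by
    intro u hu k ε
    have h1 := (mem_iff_forall_within hH).1 hu k ε
    have h2 := add_half_le_height_intCast (H := H) (ε := ε) (k := k) (u := u) (a := ε * u k)
      (by push_cast; exact h1)
    push_cast at h2
    linarith
  -- If both ends are in `H`, heights along the edge are at least the smaller of the end heights, so
  -- the edge stays strictly inside.
  by_cases hboth : v ∈ H ∧ w ∈ H
  · exfalso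
    obtain ⟨k, ε, hk⟩ := hbd
    have hv := hgap hboth.1 k ε
    have hw := hgap hboth.2 k ε
    by_cases hkj : k = j
    · subst hkj
      have e1 := h.height_eq (H := H) (ε := ε) le_rfl
      have e2 := h.symm.height_eq (H := H) (ε := ε) le_rfl
      rw [← e1] at hv
      rw [← e2] at hw
      have := (hxj ε).1.trans_lt (max_lt hv hw)
      linarith
    · have hne := h.eq_of_ne k hkj
      rw [← hne.1, ← hne.2] at hw
      rw [← hne.2] at hv
      have := (lt_min hv hw).trans_le (h.min_le_height ε k)
      linarith
  · have hex : ∃ m, ¬ (Within H m (fun i => (v i : ℝ)) ∧ Within H m fun i => (w i : ℝ)) := by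
      by_contra! hc
      exact hboth ⟨(mem_iff_forall_within hH).2 fun k => (hc k).1,
        (mem_iff_forall_within hH).2 fun k => (hc k).2⟩
    obtain ⟨m, hm, hmin⟩ := WellFounded.has_min (wellFounded_lt (α := Fin d))
      {m | ¬ (Within H m (fun i => (v i : ℝ)) ∧ Within H m fun i => (w i : ℝ))} hex
    have hlt : ∀ k < m, Within H k (fun i => (v i : ℝ)) ∧ Within H k fun i => (w i : ℝ) :=
      fun k hk => by
        by_contra hc
        exact hmin k hc hk
    -- Before the direction `j` the ends share coordinates and heights with `x`, which is in the
    -- region.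
    have hjm : j ≤ m := by
      by_contra hjm
      push Not at hjm
      apply hm
      have hne := h.eq_of_ne m hjm.ne
      constructor
      · intro ε
        rw [← h.height_eq hjm.le]
        simpa only [hne.2] using hx m ε
      · intro ε
        rw [← h.symm.height_eq hjm.le]
        simpa only [hne.2, hne.1] using hx m ε
    -- If both ends left at `m`, their coordinates there would be nonzero and differ by at most one,
    -- so they would leave on the same side, and `x` between them too.
    have hone : Within H m (fun i => (v i : ℝ)) ∨ Within H m fun i => (w i : ℝ) := by
      by_contra! hc
      obtain ⟨hv, hw⟩ := hc
      have hv' := hv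
      have hw' := hw
      rw [within_intCast_iff hH] at hv' hw'
      push Not at hv' hw'
      unfold Within at hv hw
      push Not at hv hw
      obtain ⟨ε, hε⟩ := hv
      obtain ⟨δ, hδ⟩ := hw
      have hpos : ∀ (u : Fin d → ℤ) (ε : ℤˣ), (height H ε m fun i => (u i : ℝ)) <
          ((ε : ℤ) : ℝ) * u m → 0 < (ε : ℤ) * u m := by
        intro u ε hlt
        have h1 := (height_pos H ε m fun i => (u i : ℝ)).trans hlt
        exact_mod_cast h1
      have hεδ : ε = δ := by
        have h1 := hpos v ε hε
        have h2 := hpos w δ hδ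
        have h3 : |v m - w m| ≤ 1 := by
          by_cases hmj : m = j
          · rw [hmj]; exact h.adj.le
          · rw [(h.eq_of_ne m hmj).1]; simp
        rw [abs_le] at h3
        rcases Int.units_eq_one_or ε with rfl | rfl <;>
          rcases Int.units_eq_one_or δ with rfl | rfl <;> simp at h1 h2 ⊢ <;> omega
      subst hεδ
      by_cases hmj : m = j
      · subst hmj
        rw [← h.height_eq le_rfl] at hε
        rw [← h.symm.height_eq le_rfl] at hδ
        have := (lt_min hε hδ).trans_le (hxj ε).2
        exact absurd (hx m ε) (not_le.2 this)
      · have hne := h.eq_of_ne m hmj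
        have h1 := (h.height_le_max (H := H) ε m).trans_lt (max_lt hε (by
          rw [hne.1]; exact hδ))
        rw [← hne.2] at h1
        exact absurd (hx m ε) (not_le.2 h1)
    rcases hone with h1 | h1
    · exact Or.inl ((h.symm.mem_of_not_within hH hx hjm (fun k hk => (hlt k hk).1)
        (fun h2 => hm ⟨h1, h2⟩) h1).symm)
    · exact Or.inr (h.mem_of_not_within hH hx hjm (fun k hk => (hlt k hk).2)
        (fun h2 => hm ⟨h2, h1⟩) h1)

end Lattice

/-! ### The boundary of the region is a sphere around the origin -/

noncomputable section Surface

variable {d : ℕ} {H : Finset (Fin d → ℤ)}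

/-- The triangular map that carries the region around `H` to the cube `[-1,1]^d`. -/
def cubeMap (H : Finset (Fin d → ℤ)) (x : Fin d → ℝ) : Fin d → ℝ :=
  fun k => max 0 (x k) / height H 1 k x - max 0 (-x k) / height H (-1) k x

/-- The boundary of the region around `H`. -/
def surface (H : Finset (Fin d → ℤ)) : Set (EuclideanSpace ℝ (Fin d)) :=
  {x | ‖cubeMap H x‖ = 1}

theorem continuous_cubeMap (H : Finset (Fin d → ℤ)) : Continuous (cubeMap H) := by
  refine continuous_pi fun k => ?_
  refine Continuous.sub (Continuous.div ?_ (continuous_height H 1 k) fun x => (height_pos _ _ _ _).ne')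
    (Continuous.div ?_ (continuous_height H (-1) k) fun x => (height_pos _ _ _ _).ne')
  · exact continuous_const.max (continuous_apply k)
  · exact continuous_const.max (continuous_apply k).neg

theorem cubeMap_zero (H : Finset (Fin d → ℤ)) : cubeMap H 0 = 0 := by
  funext k; simp [cubeMap]

theorem cubeMap_of_nonneg {x : Fin d → ℝ} {k : Fin d} (h : 0 ≤ x k) :
    cubeMap H x k = x k / height H 1 k x := by
  simp [cubeMap, max_eq_right h, max_eq_left (neg_nonpos.2 h)]

theorem cubeMap_of_nonpos {x : Fin d → ℝ} {k : Fin d} (h : x k ≤ 0) :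
    cubeMap H x k = x k / height H (-1) k x := by
  simp [cubeMap, max_eq_left h, max_eq_right (neg_nonneg.2 h), neg_div]

theorem abs_cubeMap_le_one_iff {x : Fin d → ℝ} {k : Fin d} :
    |cubeMap H x k| ≤ 1 ↔ Within H k x := by
  have h1 := height_pos H 1 k x
  have h2 := height_pos H (-1) k x
  constructor
  · intro h ε
    rcases le_total 0 (x k) with hx | hx
    · rw [cubeMap_of_nonneg hx, abs_of_nonneg (by positivity), div_le_one h1] at h
      rcases Int.units_eq_one_or ε with rfl | rfl
      · simpa using h
      · simp only [Units.val_neg, Units.val_one, Int.cast_neg, Int.cast_one]; linarith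
    · rw [cubeMap_of_nonpos hx, abs_div, abs_of_nonpos hx, abs_of_pos h2, div_le_one h2] at h
      rcases Int.units_eq_one_or ε with rfl | rfl
      · simp only [Units.val_one, Int.cast_one]; linarith
      · simpa using h
  · intro h
    rcases le_total 0 (x k) with hx | hx
    · rw [cubeMap_of_nonneg hx, abs_of_nonneg (by positivity), div_le_one h1]
      simpa using h 1
    · rw [cubeMap_of_nonpos hx, abs_div, abs_of_nonpos hx, abs_of_pos h2, div_le_one h2]
      simpa using h (-1)

theorem one_le_abs_cubeMap_iff {x : Fin d → ℝ} {k : Fin d} :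
    1 ≤ |cubeMap H x k| ↔ ∃ ε : ℤˣ, height H ε k x ≤ ((ε : ℤ) : ℝ) * x k := by
  have h1 := height_pos H 1 k x
  have h2 := height_pos H (-1) k x
  constructor
  · intro h
    rcases le_total 0 (x k) with hx | hx
    · rw [cubeMap_of_nonneg hx, abs_of_nonneg (by positivity), one_le_div h1] at h
      exact ⟨1, by simpa using h⟩
    · rw [cubeMap_of_nonpos hx, abs_div, abs_of_nonpos hx, abs_of_pos h2, one_le_div h2] at h
      exact ⟨-1, by simpa using h⟩
  · rintro ⟨ε, h⟩
    rcases Int.units_eq_one_or ε with rfl | rfl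
    · simp only [Units.val_one, Int.cast_one, one_mul] at h
      have hx : 0 ≤ x k := h1.le.trans h
      rw [cubeMap_of_nonneg hx, abs_of_nonneg (by positivity), one_le_div h1]
      exact h
    · simp only [Units.val_neg, Units.val_one, Int.cast_neg, Int.cast_one, neg_mul, one_mul] at h
      have hx : x k ≤ 0 := by linarith
      rw [cubeMap_of_nonpos hx, abs_div, abs_of_nonpos hx, abs_of_pos h2, one_le_div h2]
      exact h

theorem norm_cubeMap_le_one_iff {x : Fin d → ℝ} : ‖cubeMap H x‖ ≤ 1 ↔ ∀ k, Within H k x := by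
  rw [pi_norm_le_iff_of_nonneg zero_le_one]
  simp only [Real.norm_eq_abs, abs_cubeMap_le_one_iff]

theorem one_le_norm_cubeMap_iff {x : Fin d → ℝ} :
    1 ≤ ‖cubeMap H x‖ ↔ ∃ k, ∃ ε : ℤˣ, height H ε k x ≤ ((ε : ℤ) : ℝ) * x k := by
  rw [← not_lt, pi_norm_lt_iff zero_lt_one]
  push Not
  simp only [Real.norm_eq_abs, one_le_abs_cubeMap_iff]

theorem mem_surface_iff {x : EuclideanSpace ℝ (Fin d)} : x ∈ surface H ↔
    (∀ k, Within H k x) ∧ ∃ k, ∃ ε : ℤˣ, height H ε k x ≤ ((ε : ℤ) : ℝ) * x k := by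
  rw [← norm_cubeMap_le_one_iff, ← one_le_norm_cubeMap_iff, ← le_antisymm_iff]
  rfl

/-- Triangularity: if the coordinates before `k` agree, so do the heights, and `x k` is recovered
from its sign and the quotient. -/
theorem cubeMap_injective (H : Finset (Fin d → ℤ)) : Function.Injective (cubeMap H) := by
  intro x y hxy
  have hmain : ∀ k, x k = y k := by
    intro k
    induction k using WellFoundedLT.induction with
    | _ k ih =>
    have e1 := height_congr (H := H) (ε := 1) (k := k) ih
    have e2 := height_congr (H := H) (ε := -1) (k := k) ih
    have h1 := height_pos H 1 k y
    have h2 := height_pos H (-1) k y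
    have h := congrFun hxy k
    rcases le_total 0 (x k) with hx | hx <;> rcases le_total 0 (y k) with hy | hy
    · rw [cubeMap_of_nonneg hx, cubeMap_of_nonneg hy, e1] at h
      exact (div_left_inj' h1.ne').1 h
    · rw [cubeMap_of_nonneg hx, cubeMap_of_nonpos hy, e1] at h
      have h3 : 0 ≤ x k / height H 1 k y := by positivity
      have h4 : y k / height H (-1) k y ≤ 0 := div_nonpos_of_nonpos_of_nonneg hy h2.le
      have h5 : x k / height H 1 k y = 0 := by linarith
      have h6 : y k / height H (-1) k y = 0 := by linarith
      rw [div_eq_zero_iff] at h5 h6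
      rw [h5.resolve_right h1.ne', h6.resolve_right h2.ne']
    · rw [cubeMap_of_nonpos hx, cubeMap_of_nonneg hy, e2] at h
      have h3 : 0 ≤ y k / height H 1 k y := by positivity
      have h4 : x k / height H (-1) k y ≤ 0 := div_nonpos_of_nonpos_of_nonneg hx h2.le
      have h5 : y k / height H 1 k y = 0 := by linarith
      have h6 : x k / height H (-1) k y = 0 := by linarith
      rw [div_eq_zero_iff] at h5 h6
      rw [h5.resolve_right h1.ne', h6.resolve_right h2.ne']
    · rw [cubeMap_of_nonpos hx, cubeMap_of_nonpos hy, e2] at h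
      exact (div_left_inj' h2.ne').1 h
  exact funext hmain

theorem cubeMap_surjective (H : Finset (Fin d → ℤ)) : Function.Surjective (cubeMap H) := by
  intro y
  have hmain : ∀ n ≤ d, ∃ x, ∀ k : Fin d, k.val < n → cubeMap H x k = y k := by
    intro n
    induction n with
    | zero => intro _; exact ⟨0, fun k hk => absurd hk (Nat.not_lt_zero _)⟩
    | succ n ih =>
      intro hn
      obtain ⟨x, hx⟩ := ih (by omega)
      let k : Fin d := ⟨n, by omega⟩
      let c : ℝ := if 0 ≤ y k then y k * height H 1 k x else y k * height H (-1) k x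
      have hagree : ∀ (j : Fin d), j ≤ k → ∀ i < j, Function.update x k c i = x i :=
        fun j hj i hi => Function.update_of_ne (hi.trans_le hj).ne _ _
      refine ⟨Function.update x k c, fun j hj => ?_⟩
      have hjk : j ≤ k := Fin.le_def.2 (Nat.lt_succ_iff.1 hj)
      have e := fun ε => height_congr (H := H) (ε := ε) (hagree j hjk)
      rcases hjk.eq_or_lt with rfl | hlt
      · have h1 := height_pos H 1 k x
        have h2 := height_pos H (-1) k x
        by_cases hy : 0 ≤ y k
        · have hc : c = y k * height H 1 k x := if_pos hy
          rw [cubeMap_of_nonneg (by rw [Function.update_self, hc]; positivity), e,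
            Function.update_self, hc, mul_div_cancel_right₀ _ h1.ne']
        · have hc : c = y k * height H (-1) k x := if_neg hy
          rw [cubeMap_of_nonpos (by rw [Function.update_self, hc]; nlinarith), e,
            Function.update_self, hc, mul_div_cancel_right₀ _ h2.ne']
      · rw [← hx j (Fin.lt_def.1 hlt)]
        simp only [cubeMap, e, Function.update_of_ne hlt.ne]
  obtain ⟨x, hx⟩ := hmain d le_rfl
  exact ⟨x, funext fun k => hx k k.2⟩

/-- The region around `H` stays close to `H`. -/
theorem exists_mem_abs_le (hH : IsComb H) {x : Fin d → ℝ} (hx : ∀ k, Within H k x) :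
    ∃ v ∈ H, ∀ i, |x i| ≤ |(v i : ℝ)| + 1 := by
  have hmain : ∀ n ≤ d, ∃ v ∈ H, (∀ i : Fin d, n ≤ i.val → v i = 0) ∧
      ∀ i : Fin d, i.val < n → |x i| ≤ |(v i : ℝ)| + 1 := by
    intro n
    induction n with
    | zero => intro _; exact ⟨0, hH.zero_mem, fun i _ => rfl, fun i hi => absurd hi (Nat.not_lt_zero _)⟩
    | succ n ih =>
      intro hn
      let k : Fin d := ⟨n, by omega⟩
      obtain ⟨ε, hε⟩ : ∃ ε : ℤˣ, |x k| = ((ε : ℤ) : ℝ) * x k := by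
        rcases abs_choice (x k) with h | h
        · exact ⟨1, by simpa using h⟩
        · exact ⟨-1, by simpa using h⟩
      have h1 := hx k ε
      rw [← hε, le_height_iff] at h1
      by_cases hhalf : |x k| ≤ 1 / 2
      · obtain ⟨v, hv, hv0, hvx⟩ := ih (by omega)
        refine ⟨v, hv, fun i hi => hv0 i (by omega), fun i hi => ?_⟩
        rcases Nat.lt_succ_iff_lt_or_eq.1 hi with h | h
        · exact hvx i h
        · have : i = k := Fin.ext h
          rw [this]
          linarith [abs_nonneg (v k : ℝ)]
      -- Some spike reaches `|x k|`. Its vertex is close to `x` in all earlier coordinates as well,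
      -- so it replaces the previous choice altogether.
      · obtain ⟨v, hv, hvk⟩ := h1.resolve_left hhalf
        unfold spike at hvk
        have hb : bump k v x ≠ 0 := by
          intro hb
          rw [hb, mul_zero, add_zero] at hvk
          exact hhalf hvk
        split_ifs at hvk with hif
        · refine ⟨v, hv, fun i hi => hif i (Fin.lt_def.2 hi), fun i hi => ?_⟩
          rcases Nat.lt_succ_iff_lt_or_eq.1 hi with h | h
          · have h2 := abs_lt_one_of_bump_ne_zero hb i (Fin.lt_def.2 h)
            have h3 := abs_sub_abs_le_abs_sub (x i) (v i : ℝ)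
            linarith
          · have : i = k := Fin.ext h
            rw [this]
            have h2 : ((max 0 (ε * v k) : ℤ) : ℝ) ≤ |(v k : ℝ)| := by
              have : max 0 ((ε : ℤ) * v k) ≤ |v k| := by
                refine max_le (abs_nonneg _) ((le_abs_self _).trans ?_)
                rcases Int.units_eq_one_or ε with rfl | rfl <;> simp
              exact_mod_cast this
            have h3 := bump_le_one k v x
            have h4 := bump_nonneg k v x
            have h5 : (0 : ℝ) ≤ ((max 0 (ε * v k) : ℤ) : ℝ) := by exact_mod_cast le_max_left _ _
            nlinarith
        · rw [zero_mul] at hvk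
          exact absurd (by linarith) hhalf
  obtain ⟨v, hv, -, hvx⟩ := hmain d le_rfl
  exact ⟨v, hv, fun i => hvx i i.2⟩

theorem isBounded_region (hH : IsComb H) :
    Bornology.IsBounded {x : EuclideanSpace ℝ (Fin d) | ‖cubeMap H x‖ ≤ 1} := by
  have hfin : Bornology.IsBounded (WithLp.ofLp ''
      {x : EuclideanSpace ℝ (Fin d) | ‖cubeMap H x‖ ≤ 1}) := by
    rw [isBounded_iff_forall_norm_le]
    refine ⟨∑ v ∈ H, ∑ i, (|(v i : ℝ)| + 1), ?_⟩
    rintro _ ⟨x, hx, rfl⟩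
    obtain ⟨v, hv, hvx⟩ := exists_mem_abs_le hH (norm_cubeMap_le_one_iff.1 hx)
    have hnn : ∀ w : Fin d → ℤ, 0 ≤ ∑ i, (|(w i : ℝ)| + 1) := fun w =>
      Finset.sum_nonneg fun i _ => by positivity
    rw [pi_norm_le_iff_of_nonneg (Finset.sum_nonneg fun w _ => hnn w)]
    intro i
    calc ‖x i‖ ≤ |(v i : ℝ)| + 1 := hvx i
      _ ≤ ∑ i, (|(v i : ℝ)| + 1) :=
        Finset.single_le_sum (f := fun i => |(v i : ℝ)| + 1) (fun i _ => by positivity)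
          (Finset.mem_univ i)
      _ ≤ _ := Finset.single_le_sum (f := fun w : Fin d → ℤ => ∑ i, (|(w i : ℝ)| + 1))
          (fun w _ => hnn w) hv
  have := (PiLp.antilipschitzWith_ofLp 2 (fun _ : Fin d => ℝ)).isBounded_preimage hfin
  exact this.subset (Set.subset_preimage_image _ _)

theorem continuous_cubeMap_ofLp (H : Finset (Fin d → ℤ)) :
    Continuous fun x : EuclideanSpace ℝ (Fin d) => cubeMap H x :=
  (continuous_cubeMap H).comp (PiLp.continuous_ofLp 2 _)

theorem isClosed_surface (H : Finset (Fin d → ℤ)) : IsClosed (surface H) :=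
  isClosed_eq (continuous_cubeMap_ofLp H).norm continuous_const

theorem isBounded_surface (hH : IsComb H) : Bornology.IsBounded (surface H) :=
  (isBounded_region hH).subset fun _ hx => le_of_eq hx

theorem isSemilinear_surface (H : Finset (Fin d → ℤ)) : IsSemilinear (surface H) := by
  have heq : surface H = (⋂ k, ⋂ ε : ℤˣ, {x : EuclideanSpace ℝ (Fin d) |
        (((ε : ℤ) : ℝ) • coordAffine k) x ≤ height H ε k x}) ∩
      ⋃ k, ⋃ ε : ℤˣ, {x : EuclideanSpace ℝ (Fin d) |
        height H ε k x ≤ (((ε : ℤ) : ℝ) • coordAffine k) x} := by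
    ext x
    rw [mem_surface_iff]
    simp only [Within, Set.mem_inter_iff, Set.mem_iInter, Set.mem_iUnion, Set.mem_ofPred_eq,
      AffineMap.coe_smul, Pi.smul_apply, smul_eq_mul, coordAffine_apply]
  rw [heq]
  exact (IsSemilinear.iInter fun k => IsSemilinear.iInter fun ε =>
      (isPiecewiseLinear_height H ε k _).2).inter
    (IsSemilinear.iUnion fun k => IsSemilinear.iUnion fun ε =>
      (isPiecewiseLinear_height H ε k _).1)

theorem toLp_cubeMap_ne_zero (x : surface H) : WithLp.toLp 2 (cubeMap H x.1) ≠ 0 := by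
  intro h
  have h1 : cubeMap H x.1 = 0 := by simpa using h
  have h2 : ‖cubeMap H x.1‖ = 1 := x.2
  rw [h1, norm_zero] at h2
  exact zero_ne_one h2

/-- The radial image of the surface on the unit sphere. -/
def toUnitSphere (H : Finset (Fin d → ℤ)) (x : surface H) :
    Metric.sphere (0 : EuclideanSpace ℝ (Fin d)) 1 :=
  ⟨‖WithLp.toLp 2 (cubeMap H x.1)‖⁻¹ • WithLp.toLp 2 (cubeMap H x.1), by
    rw [mem_sphere_zero_iff_norm, norm_smul, norm_inv, norm_norm,
      inv_mul_cancel₀ (norm_ne_zero_iff.2 (toLp_cubeMap_ne_zero x))]⟩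

theorem continuous_toUnitSphere (H : Finset (Fin d → ℤ)) : Continuous (toUnitSphere H) := by
  have h : Continuous fun x : surface H => WithLp.toLp 2 (cubeMap H x.1) :=
    (PiLp.continuous_toLp 2 _).comp ((continuous_cubeMap_ofLp H).comp continuous_subtype_val)
  exact ((h.norm.inv₀ fun x => norm_ne_zero_iff.2 (toLp_cubeMap_ne_zero x)).smul h).subtype_mk _

theorem toUnitSphere_bijective (H : Finset (Fin d → ℤ)) :
    Function.Bijective (toUnitSphere H) := by
  constructor
  · intro x y hxy
    have h := congrArg (fun z => z.1.ofLp) hxy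
    have hx0 := norm_pos_iff.2 (toLp_cubeMap_ne_zero x)
    have hy0 := norm_pos_iff.2 (toLp_cubeMap_ne_zero y)
    simp only [toUnitSphere, WithLp.ofLp_smul] at h
    have hx : ‖cubeMap H x.1‖ = 1 := x.2
    have hy : ‖cubeMap H y.1‖ = 1 := y.2
    have hn := congrArg norm h
    rw [norm_smul, norm_smul, hx, hy, mul_one, mul_one, norm_inv, norm_inv, norm_norm,
      norm_norm] at hn
    rw [hn] at h
    have h2 := smul_right_injective _ (inv_ne_zero hy0.ne') h
    have h3 := cubeMap_injective H h2
    exact Subtype.ext (WithLp.ofLp_injective 2 h3)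
  · rintro ⟨y, hy⟩
    rw [mem_sphere_zero_iff_norm] at hy
    have hy0 : y.ofLp ≠ 0 := by
      intro h
      have : y = 0 := by simpa using h
      rw [this, norm_zero] at hy
      exact zero_ne_one hy
    have hpos := norm_pos_iff.2 hy0
    obtain ⟨x, hx⟩ := cubeMap_surjective H (‖y.ofLp‖⁻¹ • y.ofLp)
    refine ⟨⟨WithLp.toLp 2 x, ?_⟩, ?_⟩
    · change ‖cubeMap H x‖ = 1
      rw [hx, norm_smul, norm_inv, norm_norm, inv_mul_cancel₀ hpos.ne']
    · apply Subtype.ext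
      simp only [toUnitSphere]
      rw [hx, WithLp.toLp_smul, WithLp.toLp_ofLp, norm_smul, hy, norm_inv, norm_norm, mul_one,
        inv_inv, smul_smul, mul_inv_cancel₀ hpos.ne', one_smul]

theorem isSphere_surface (hH : IsComb H) : IsSphere (surface H) := by
  refine ⟨exists_simplicialComplex_of_isSemilinear (isSemilinear_surface H) (isClosed_surface H)
    (isBounded_surface hH), ?_⟩
  have : CompactSpace (surface H) := isCompact_iff_compactSpace.1
    (Metric.isCompact_of_isClosed_isBounded (isClosed_surface H) (isBounded_surface hH))
  exact ⟨Continuous.homeoOfEquivCompactToT2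
    (f := Equiv.ofBijective _ (toUnitSphere_bijective H)) (continuous_toUnitSphere H)⟩

/-- On a connected subset of the complement through the origin the norm of `cubeMap` cannot pass the
value one, so the component stays in the bounded region. -/
theorem zero_mem_inside_surface (hH : IsComb H) : 0 ∈ inside (surface H) := by
  have h0 : (0 : EuclideanSpace ℝ (Fin d)) ∈ (surface H)ᶜ := by
    intro h
    have h1 : ‖cubeMap H (0 : EuclideanSpace ℝ (Fin d)).ofLp‖ = 1 := h
    rw [WithLp.ofLp_zero, cubeMap_zero, norm_zero] at h1
    exact zero_ne_one h1
  refine ⟨h0, (isBounded_region hH).subset fun x hx => ?_⟩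
  by_contra hc
  rw [Set.mem_ofPred_eq, not_le] at hc
  have hpre := (isPreconnected_connectedComponentIn (x := 0) (F := (surface H)ᶜ)).image
    (fun x => ‖cubeMap H x‖) (continuous_cubeMap_ofLp H).norm.continuousOn
  have h1 : (0 : ℝ) ∈ (fun x : EuclideanSpace ℝ (Fin d) => ‖cubeMap H x‖) ''
      connectedComponentIn (surface H)ᶜ 0 :=
    ⟨0, mem_connectedComponentIn h0, by simp [cubeMap_zero]⟩
  obtain ⟨y, hy, hy1⟩ := hpre.Icc_subset h1 ⟨x, hx, rfl⟩ ⟨zero_le_one, hc.le⟩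
  exact connectedComponentIn_subset _ _ hy hy1

theorem toSpace_notMem_surface (v : Fin d → ℤ) : toSpace v ∉ surface H := by
  intro h
  rw [mem_surface_iff] at h
  obtain ⟨h1, k, ε, hk⟩ := h
  have h2 := h1 k ε
  have h3 := add_half_le_height_intCast (H := H) (ε := ε) (k := k) (u := v) (a := ε * v k)
    (by push_cast; exact h2)
  push_cast at h3
  have h4 : height H ε k (fun i => (v i : ℝ)) ≤ ((ε : ℤ) : ℝ) * v k := hk
  linarith

theorem exists_onEdge_of_mem_bond {v w : Fin d → ℤ} (h : (lattice d).Adj v w)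
    {x : EuclideanSpace ℝ (Fin d)} (hx : x ∈ bond v w) : ∃ j, OnEdge j v w x := by
  have hsum : ∑ i, (v i - w i) ^ 2 = 1 := h
  obtain ⟨j, hj⟩ : ∃ j, v j - w j ≠ 0 := by
    by_contra! hc
    simp [hc] at hsum
  have hsplit := Finset.add_sum_erase Finset.univ (fun i => (v i - w i) ^ 2) (Finset.mem_univ j)
  have hj1 : 1 ≤ (v j - w j) ^ 2 := by
    have := sq_pos_of_ne_zero hj
    omega
  have hnn : ∀ i ∈ Finset.univ.erase j, 0 ≤ (v i - w i) ^ 2 := fun i _ => sq_nonneg _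
  have hrest := Finset.sum_nonneg hnn
  have hr0 : ∑ i ∈ Finset.univ.erase j, (v i - w i) ^ 2 = 0 := by omega
  have hne : ∀ i, i ≠ j → v i = w i := by
    intro i hi
    have := (Finset.sum_eq_zero_iff_of_nonneg hnn).1 hr0 i (Finset.mem_erase.2 ⟨hi, Finset.mem_univ i⟩)
    have := pow_eq_zero_iff (two_ne_zero) |>.1 this
    omega
  rw [bond, segment_eq_image] at hx
  obtain ⟨t, ⟨ht0, ht1⟩, rfl⟩ := hx
  have hcoord : ∀ i, ((1 - t) • toSpace v + t • toSpace w) i = (1 - t) * v i + t * w i := by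
    intro i; simp [toSpace]
  refine ⟨j, ⟨fun i hi => ⟨hne i hi, ?_⟩, ?_, t, ht0, ht1, hcoord j⟩⟩
  · rw [hcoord, hne i hi]; ring
  · have : (v j - w j) ^ 2 = 1 := by omega
    exact (abs_eq zero_le_one).2 (mul_self_eq_one_iff.1 ((sq _).symm.trans this))

theorem mem_xor_of_bond_meets_surface (hH : IsComb H) {v w : Fin d → ℤ}
    (h : (lattice d).Adj v w) (hm : (bond v w ∩ surface H).Nonempty) :
    v ∈ H ∧ w ∉ H ∨ v ∉ H ∧ w ∈ H := by
  obtain ⟨x, hx, hxs⟩ := hm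
  obtain ⟨j, hj⟩ := exists_onEdge_of_mem_bond h hx
  rw [mem_surface_iff] at hxs
  exact hj.mem_xor hH hxs.1 hxs.2

/-- The `ℓ¹`-norm on `ℤ^d`. -/
def l1 (v : Fin d → ℤ) : ℕ := ∑ i, (v i).natAbs

theorem exists_le_l1_of_le_rad_surface (hH : IsComb H) {r : ℝ}
    (h : ENNReal.ofReal r ≤ rad (surface H)) : ∃ v ∈ H, r ≤ l1 v + d := by
  by_contra! hc
  obtain ⟨u, hu, hmax⟩ := H.exists_max_image l1 ⟨0, hH.zero_mem⟩
  have hle : rad (surface H) ≤ ENNReal.ofReal (l1 u + d) := by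
    refine iSup₂_le fun x hx => ENNReal.ofReal_le_ofReal ?_
    obtain ⟨v, hv, hvx⟩ := exists_mem_abs_le hH (mem_surface_iff.1 hx).1
    have h1 : (l1 v : ℝ) ≤ l1 u := by exact_mod_cast hmax v hv
    have h2 : (l1 v : ℝ) = ∑ i, |(v i : ℝ)| := by
      unfold l1
      push_cast
      refine Finset.sum_congr rfl fun i _ => ?_
      rw [Nat.cast_natAbs]; push_cast; rfl
    calc ∑ i, |x i| ≤ ∑ i, (|(v i : ℝ)| + 1) := Finset.sum_le_sum fun i _ => hvx i
      _ = l1 v + d := by rw [Finset.sum_add_distrib, h2]; simp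
      _ ≤ l1 u + d := by linarith
  have := (h.trans hle)
  rw [ENNReal.ofReal_le_ofReal_iff (by positivity)] at this
  linarith [hc u hu]

end Surface

/-! ### Weighted self-avoiding paths -/

noncomputable section Paths

variable {d : ℕ}

theorem IsParent.unique {v w w' : Fin d → ℤ} (h : IsParent v w) (h' : IsParent v w') : w = w' := by
  obtain ⟨k, hk, hk0, rfl⟩ := h
  obtain ⟨k', hk', hk0', rfl⟩ := h'
  rcases lt_trichotomy k k' with hlt | rfl | hlt
  · exact absurd (hk0 k' hlt) hk'
  · rfl
  · exact absurd (hk0' k hlt) hk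

/-- The neighbours of a vertex. -/
def neighbors (v : Fin d → ℤ) : Finset (Fin d → ℤ) :=
  Finset.univ.image fun q : Fin d × ℤˣ => Function.update v q.1 (v q.1 + (q.2 : ℤ))

theorem card_neighbors_le (v : Fin d → ℤ) : (neighbors v).card ≤ 2 * d := by
  refine Finset.card_image_le.trans ?_
  rw [Finset.card_univ, Fintype.card_prod, Fintype.card_fin]
  have : Fintype.card ℤˣ = 2 := rfl
  rw [this, mul_comm]

theorem adj_update {v : Fin d → ℤ} {k : Fin d} {ε : ℤ} (hε : ε ^ 2 = 1) :
    (lattice d).Adj v (Function.update v k (v k + ε)) := by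
  change ∑ i, (v i - Function.update v k (v k + ε) i) ^ 2 = 1
  rw [Finset.sum_eq_single k]
  · rw [Function.update_self]; linear_combination hε
  · intro i _ hi
    rw [Function.update_of_ne hi]; ring
  · intro h; exact absurd (Finset.mem_univ k) h

theorem exists_update_of_adj {v w : Fin d → ℤ} (h : (lattice d).Adj v w) :
    ∃ (k : Fin d) (ε : ℤˣ), w = Function.update v k (v k + (ε : ℤ)) := by
  obtain ⟨k, hk⟩ := exists_onEdge_of_mem_bond h (left_mem_segment ℝ _ _)
  have hne : ∀ i, i ≠ k → v i = w i := fun i hi => (hk.eq_of_ne i hi).1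
  have hadj := hk.adj
  obtain ⟨ε, hε⟩ : ∃ ε : ℤˣ, w k = v k + (ε : ℤ) := by
    rcases (abs_eq zero_le_one).1 hadj with h1 | h1
    · exact ⟨-1, by simp; omega⟩
    · exact ⟨1, by simp; omega⟩
  refine ⟨k, ε, funext fun i => ?_⟩
  by_cases hi : i = k
  · rw [hi, Function.update_self, hε]
  · rw [Function.update_of_ne hi, hne i hi]

theorem mem_neighbors_iff {v w : Fin d → ℤ} : w ∈ neighbors v ↔ (lattice d).Adj v w := by
  unfold neighbors
  rw [Finset.mem_image]
  constructor
  · rintro ⟨⟨k, ε⟩, -, rfl⟩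
    refine adj_update ?_
    rcases Int.units_eq_one_or ε with rfl | rfl <;> rfl
  · intro h
    obtain ⟨k, ε, rfl⟩ := exists_update_of_adj h
    exact ⟨(k, ε), Finset.mem_univ _, rfl⟩

theorem IsParent.adj {v w : Fin d → ℤ} (h : IsParent v w) : (lattice d).Adj v w := by
  obtain ⟨k, hk, -, rfl⟩ := h
  rw [sub_eq_add_neg]
  refine adj_update ?_
  rcases lt_or_gt_of_ne hk with h | h
  · rw [Int.sign_eq_neg_one_of_neg h]; rfl
  · rw [Int.sign_eq_one_of_pos h]; rfl

theorem l1_update (v : Fin d → ℤ) (k : Fin d) (a : ℤ) :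
    l1 (Function.update v k a) + (v k).natAbs = l1 v + a.natAbs := by
  unfold l1
  rw [← Finset.add_sum_erase _ _ (Finset.mem_univ k), ← Finset.add_sum_erase _ (fun i => (v i).natAbs)
    (Finset.mem_univ k), Function.update_self]
  have : ∑ i ∈ Finset.univ.erase k, (Function.update v k a i).natAbs =
      ∑ i ∈ Finset.univ.erase k, (v i).natAbs :=
    Finset.sum_congr rfl fun i hi => by rw [Function.update_of_ne (Finset.ne_of_mem_erase hi)]
  omega

theorem IsParent.l1_eq {v w : Fin d → ℤ} (h : IsParent v w) : l1 v = l1 w + 1 := by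
  obtain ⟨k, hk, -, rfl⟩ := h
  have := l1_update v k (v k - (v k).sign)
  rcases lt_or_gt_of_ne hk with h | h
  · rw [Int.sign_eq_neg_one_of_neg h] at this ⊢; omega
  · rw [Int.sign_eq_one_of_pos h] at this ⊢; omega

theorem l1_le_of_adj {v w : Fin d → ℤ} (h : (lattice d).Adj v w) : l1 w ≤ l1 v + 1 := by
  obtain ⟨k, ε, rfl⟩ := exists_update_of_adj h
  have := l1_update v k (v k + (ε : ℤ))
  rcases Int.units_eq_one_or ε with rfl | rfl
  · simp only [Units.val_one] at this ⊢; omega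
  · simp only [Units.val_neg, Units.val_one] at this ⊢; omega

open Classical in
/-- The self-avoiding paths with `n` steps that start at the origin, listed from their end. -/
def paths (d : ℕ) : ℕ → Finset (List (Fin d → ℤ))
  | 0 => {[0]}
  | n + 1 => (paths d n).biUnion fun l =>
      ((neighbors l.headI).filter fun w => w ∉ l).image fun w => w :: l

theorem mem_paths_succ {n : ℕ} {l : List (Fin d → ℤ)} : l ∈ paths d (n + 1) ↔
    ∃ t ∈ paths d n, ∃ w, (lattice d).Adj t.headI w ∧ w ∉ t ∧ l = w :: t := by
  simp only [paths, Finset.mem_biUnion, Finset.mem_image, Finset.mem_filter, mem_neighbors_iff]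
  constructor
  · rintro ⟨t, ht, w, ⟨h1, h2⟩, rfl⟩
    exact ⟨t, ht, w, h1, h2, rfl⟩
  · rintro ⟨t, ht, w, h1, h2, rfl⟩
    exact ⟨t, ht, w, ⟨h1, h2⟩, rfl⟩

theorem exists_cons_of_mem_paths {n : ℕ} {l : List (Fin d → ℤ)} (h : l ∈ paths d n) :
    ∃ v t, l = v :: t := by
  cases n with
  | zero =>
    rw [paths, Finset.mem_singleton] at h
    exact ⟨0, [], h⟩
  | succ n =>
    obtain ⟨t, -, w, -, -, rfl⟩ := mem_paths_succ.1 h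
    exact ⟨w, t, rfl⟩

open Classical in
/-- The edges of a path whose steps do not lead to the parent of a vertex. -/
def upEdges : List (Fin d → ℤ) → Finset (Sym2 (Fin d → ℤ))
  | [] => ∅
  | [_] => ∅
  | w :: v :: t => if IsParent v w then upEdges (v :: t) else insert s(v, w) (upEdges (v :: t))

open Classical in
/-- The weight of a path: a factor `u` for each step to a parent and `q` for each other step. -/
def weight (u q : ℝ) : List (Fin d → ℤ) → ℝ
  | [] => 1
  | [_] => 1
  | w :: v :: t => (if IsParent v w then u else q) * weight u q (v :: t)

theorem weight_nonneg {u q : ℝ} (hu : 0 ≤ u) (hq : 0 ≤ q) :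
    ∀ l : List (Fin d → ℤ), 0 ≤ weight u q l
  | [] => zero_le_one
  | [_] => zero_le_one
  | w :: v :: t => by
    rw [weight]
    refine mul_nonneg ?_ (weight_nonneg hu hq (v :: t))
    split_ifs <;> assumption

theorem upEdges_mono (w v : Fin d → ℤ) (t : List (Fin d → ℤ)) :
    upEdges (v :: t) ⊆ upEdges (w :: v :: t) := by
  rw [upEdges]
  split_ifs
  · exact Finset.Subset.refl _
  · exact Finset.subset_insert _ _

theorem mem_of_mem_upEdges {n : ℕ} : ∀ {l : List (Fin d → ℤ)}, l ∈ paths d n →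
    ∀ e ∈ upEdges l, e ∈ (lattice d).edgeSet ∧ ∀ x ∈ e, x ∈ l := by
  induction n with
  | zero =>
    intro l hl e he
    rw [paths, Finset.mem_singleton] at hl
    rw [hl, upEdges] at he
    exact absurd he (Finset.notMem_empty _)
  | succ n ih =>
    intro l hl e he
    obtain ⟨t, ht, w, hw, -, rfl⟩ := mem_paths_succ.1 hl
    obtain ⟨v, t, rfl⟩ := exists_cons_of_mem_paths ht
    have hold : e ∈ upEdges (v :: t) → e ∈ (lattice d).edgeSet ∧ ∀ x ∈ e, x ∈ w :: v :: t :=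
      fun he => ⟨(ih ht e he).1, fun x hx => List.mem_cons_of_mem _ ((ih ht e he).2 x hx)⟩
    rw [upEdges] at he
    split_ifs at he
    · exact hold he
    · rcases Finset.mem_insert.1 he with rfl | he
      · refine ⟨hw, fun x hx => ?_⟩
        rcases Sym2.mem_iff.1 hx with rfl | rfl <;> simp
      · exact hold he

/-- A parent step lowers the ℓ¹-norm by exactly one and any other step raises it by at most one.
Self-avoidance makes the edge of each non-parent step new, so the cardinality counts these steps. -/
theorem pow_card_upEdges_le {p u q : ℝ} (hu0 : 0 ≤ u) (hu1 : u ≤ 1) (hq : 0 ≤ q)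
    (hp : p = q * u) {n : ℕ} : ∀ {l : List (Fin d → ℤ)}, l ∈ paths d n →
    p ^ (upEdges l).card ≤ u ^ l1 l.headI * weight u q l := by
  have hp0 : 0 ≤ p := hp ▸ mul_nonneg hq hu0
  induction n with
  | zero =>
    intro l hl
    rw [paths, Finset.mem_singleton] at hl
    subst hl
    simp [upEdges, weight, l1]
  | succ n ih =>
    intro l hl
    obtain ⟨t, ht, w, hw, hwt, rfl⟩ := mem_paths_succ.1 hl
    obtain ⟨v, t, rfl⟩ := exists_cons_of_mem_paths ht
    have h := ih ht
    have hwn := weight_nonneg hu0 hq (v :: t)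
    simp only [List.headI_cons] at h hw ⊢
    rw [upEdges, weight]
    by_cases hpar : IsParent v w
    · rw [if_pos hpar, if_pos hpar]
      rw [hpar.l1_eq, pow_succ] at h
      linarith
    · rw [if_neg hpar, if_neg hpar, Finset.card_insert_of_notMem, pow_succ]
      · have h1 : u ^ (l1 v + 1) ≤ u ^ l1 w := pow_le_pow_of_le_one hu0 hu1 (l1_le_of_adj hw)
        calc p ^ (upEdges (v :: t)).card * p
            ≤ u ^ l1 v * weight u q (v :: t) * p := mul_le_mul_of_nonneg_right h hp0
          _ = u ^ (l1 v + 1) * (q * weight u q (v :: t)) := by rw [hp, pow_succ]; ring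
          _ ≤ u ^ l1 w * (q * weight u q (v :: t)) :=
            mul_le_mul_of_nonneg_right h1 (mul_nonneg hq hwn)
      · intro hmem
        exact hwt ((mem_of_mem_upEdges ht _ hmem).2 w (Sym2.mem_mk_right _ _))

-- Parents are unique, so at most one extension has weight `u`; if none has, `q ≤ u` gives the same
-- bound.
open Classical in
theorem sum_weight_extensions_le {u q : ℝ} (hq : 0 ≤ q) {v : Fin d → ℤ}
    {A : Finset (Fin d → ℤ)} {m : ℕ} (hA : A.card ≤ m + 1) (hqu : q ≤ u) :
    ∑ w ∈ A, (if IsParent v w then u else q) ≤ m * q + u := by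
  by_cases hpar : ∃ w ∈ A, IsParent v w
  · obtain ⟨w, hwA, hw⟩ := hpar
    rw [← Finset.add_sum_erase _ _ hwA, if_pos hw]
    have h1 : ∑ x ∈ A.erase w, (if IsParent v x then u else q) = ∑ x ∈ A.erase w, q :=
      Finset.sum_congr rfl fun x hx => if_neg fun hx' =>
        Finset.ne_of_mem_erase hx (hx'.unique hw)
    rw [h1, Finset.sum_const, nsmul_eq_mul, Finset.card_erase_of_mem hwA]
    have : ((A.card - 1 : ℕ) : ℝ) ≤ m := by exact_mod_cast (by omega)
    nlinarith
  · push Not at hpar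
    have h1 : ∑ x ∈ A, (if IsParent v x then u else q) = ∑ x ∈ A, q :=
      Finset.sum_congr rfl fun x hx => if_neg (hpar x hx)
    rw [h1, Finset.sum_const, nsmul_eq_mul]
    have : (A.card : ℝ) ≤ m + 1 := by exact_mod_cast hA
    nlinarith

open Classical in
theorem sum_weight_paths_succ_le {u q : ℝ} (hu : 0 ≤ u) (hq : 0 ≤ q) {c : ℝ} {n : ℕ}
    (hc : ∀ l ∈ paths d n, ∑ w ∈ (neighbors l.headI).filter (fun w => w ∉ l),
      (if IsParent l.headI w then u else q) ≤ c) :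
    ∑ l ∈ paths d (n + 1), weight u q l ≤ c * ∑ l ∈ paths d n, weight u q l := by
  rw [paths]
  rw [Finset.sum_biUnion, Finset.mul_sum]
  swap
  · intro l _ l' _ hne
    refine Finset.disjoint_left.2 fun x hx hx' => hne ?_
    obtain ⟨_, _, rfl⟩ := Finset.mem_image.1 hx
    obtain ⟨_, _, h⟩ := Finset.mem_image.1 hx'
    exact (List.cons.inj h).2.symm
  refine Finset.sum_le_sum fun l hl => ?_
  rw [Finset.sum_image fun a _ b _ hab => (List.cons.inj hab).1]
  have h1 : ∑ w ∈ (neighbors l.headI).filter (fun w => w ∉ l), weight u q (w :: l) =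
      (∑ w ∈ (neighbors l.headI).filter (fun w => w ∉ l),
        (if IsParent l.headI w then u else q)) * weight u q l := by
    rw [Finset.sum_mul]
    refine Finset.sum_congr rfl fun w _ => ?_
    obtain ⟨v, t, rfl⟩ := exists_cons_of_mem_paths hl
    rw [weight]; rfl
  rw [h1]
  exact mul_le_mul_of_nonneg_right (hc l hl) (weight_nonneg hu hq l)

/-- After the first step the previous vertex is forbidden, which leaves at most `2d - 1` extensions.
The first step is bounded crudely, since it only affects the constant. -/
theorem sum_weight_paths_le (hd : 1 ≤ d) {u q : ℝ} (hu : 0 ≤ u) (hq : 0 ≤ q) (hqu : q ≤ u)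
    (n : ℕ) : ∑ l ∈ paths d (n + 1), weight u q l ≤
      ((2 * d : ℕ) * q + u) * (((2 * d - 2 : ℕ) : ℝ) * q + u) ^ n := by
  classical
  induction n with
  | zero =>
    refine (sum_weight_paths_succ_le hu hq (c := (2 * d : ℕ) * q + u) ?_).trans ?_
    · intro l _
      refine sum_weight_extensions_le hq ?_ hqu
      exact (Finset.card_filter_le _ _).trans ((card_neighbors_le _).trans (Nat.le_succ _))
    · simp [paths, weight]
  | succ n ih =>
    refine (sum_weight_paths_succ_le hu hq (c := ((2 * d - 2 : ℕ) : ℝ) * q + u) ?_).trans ?_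
    · intro l hl
      obtain ⟨t, ht, w, hw, hwt, rfl⟩ := mem_paths_succ.1 hl
      obtain ⟨v, t, rfl⟩ := exists_cons_of_mem_paths ht
      refine sum_weight_extensions_le hq ?_ hqu
      have hsub : (neighbors (w :: v :: t).headI).filter (fun x => x ∉ w :: v :: t) ⊆
          (neighbors w).erase v := by
        intro x hx
        rw [Finset.mem_filter] at hx
        refine Finset.mem_erase.2 ⟨fun h => hx.2 (by simp [h]), hx.1⟩
      refine (Finset.card_le_card hsub).trans ?_
      have hv : v ∈ neighbors w := mem_neighbors_iff.2 hw.symm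
      rw [Finset.card_erase_of_mem hv]
      have := card_neighbors_le w
      omega
    · have : 0 ≤ ((2 * d - 2 : ℕ) : ℝ) * q + u := by positivity
      rw [pow_succ]
      nlinarith [mul_le_mul_of_nonneg_left ih this]

end Paths

/-! ### The cluster of the origin and the random sphere -/

noncomputable section Cluster

variable {d : ℕ}

/-- All steps of the path that do not lead to a parent use open edges. -/
def IsOpenPath (ω : Config d) (l : List (Fin d → ℤ)) : Prop :=
  ∀ e ∈ upEdges l, ∃ h : e ∈ (lattice d).edgeSet, ω ⟨e, h⟩ = true

/-- The vertices that can be reached from the origin by steps through open edges and steps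
to parents. -/
def cluster (ω : Config d) : Set (Fin d → ℤ) :=
  {v | ∃ n, ∃ l ∈ paths d n, l.headI = v ∧ IsOpenPath ω l}

theorem zero_mem_cluster (ω : Config d) : 0 ∈ cluster ω :=
  ⟨0, [0], by simp [paths], rfl, fun e he => by simp [upEdges] at he⟩

theorem mem_cluster_of_mem_path {ω : Config d} {n : ℕ} : ∀ {l}, l ∈ paths d n →
    IsOpenPath ω l → ∀ w ∈ l, w ∈ cluster ω := by
  induction n with
  | zero =>
    intro l hl _ w hw
    rw [paths, Finset.mem_singleton] at hl
    rw [hl, List.mem_singleton] at hw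
    rw [hw]
    exact zero_mem_cluster ω
  | succ n ih =>
    intro l hl hopen w hw
    have hl' := hl
    obtain ⟨t, ht, x, hx, hxt, rfl⟩ := mem_paths_succ.1 hl
    obtain ⟨v, t, rfl⟩ := exists_cons_of_mem_paths ht
    rcases List.mem_cons.1 hw with rfl | hw
    · exact ⟨_, _, hl', rfl, hopen⟩
    · exact ih ht (fun e he => hopen e (upEdges_mono _ _ _ he)) w hw

/-- Self-avoidance in the definition of the cluster loses nothing: a vertex already on the path is
reached by a shorter piece of it. -/
theorem mem_cluster_of_step {ω : Config d} {v w : Fin d → ℤ} (hv : v ∈ cluster ω)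
    (h : (lattice d).Adj v w) (hs : IsParent v w ∨ ω ⟨s(v, w), h⟩ = true) : w ∈ cluster ω := by
  obtain ⟨n, l, hl, rfl, hopen⟩ := hv
  by_cases hw : w ∈ l
  · exact mem_cluster_of_mem_path hl hopen w hw
  · refine ⟨n + 1, w :: l, mem_paths_succ.2 ⟨l, hl, w, h, hw, rfl⟩, rfl, ?_⟩
    obtain ⟨v, t, rfl⟩ := exists_cons_of_mem_paths hl
    intro e he
    rw [upEdges] at he
    split_ifs at he with hpar
    · exact hopen e he
    · rcases Finset.mem_insert.1 he with rfl | he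
      · exact ⟨h, hs.resolve_left hpar⟩
      · exact hopen e he

theorem isComb_cluster {ω : Config d} (h : (cluster ω).Finite) : IsComb h.toFinset where
  zero_mem := by simpa using zero_mem_cluster ω
  parent_mem v hv w hvw := by
    rw [Set.Finite.mem_toFinset] at hv ⊢
    exact mem_cluster_of_step hv hvw.adj (Or.inl hvw)

/-- An open edge between the cluster and its complement would allow a further step. -/
theorem isClosedSphereAroundOrigin_surface_cluster {ω : Config d} (h : (cluster ω).Finite) :
    IsClosedSphereAroundOrigin ω (surface h.toFinset) := by
  have hH := isComb_cluster h
  refine ⟨isSphere_surface hH, toSpace_notMem_surface, zero_mem_inside_surface hH, ?_⟩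
  intro v w hvw hm
  have hxor := mem_xor_of_bond_meets_surface hH hvw hm
  simp only [Set.Finite.mem_toFinset] at hxor
  by_contra hopen
  rw [Bool.not_eq_false] at hopen
  rcases hxor with ⟨hv, hw⟩ | ⟨hv, hw⟩
  · exact hw (mem_cluster_of_step hv hvw (Or.inr hopen))
  · refine hv (mem_cluster_of_step hw hvw.symm (Or.inr ?_))
    rw [← hopen]
    congr 2
    exact Sym2.eq_swap

theorem measurableSet_edge_open (e : Sym2 (Fin d → ℤ)) :
    MeasurableSet {ω : Config d | ∃ h : e ∈ (lattice d).edgeSet, ω ⟨e, h⟩ = true} := by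
  by_cases h : e ∈ (lattice d).edgeSet
  · simp only [h, exists_true_left]
    have hm : Measurable fun ω : Config d => ω ⟨e, h⟩ := measurable_pi_apply _
    exact hm (measurableSet_singleton true)
  · simp [h]

theorem measurableSet_isOpenPath (l : List (Fin d → ℤ)) :
    MeasurableSet {ω : Config d | IsOpenPath ω l} := by
  have : {ω : Config d | IsOpenPath ω l} = ⋂ e ∈ upEdges l,
      {ω : Config d | ∃ h : e ∈ (lattice d).edgeSet, ω ⟨e, h⟩ = true} := by
    ext ω; simp [IsOpenPath]
  rw [this]
  exact Finset.measurableSet_biInter _ fun e _ => measurableSet_edge_open e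

theorem measurableSet_mem_cluster (v : Fin d → ℤ) :
    MeasurableSet {ω : Config d | v ∈ cluster ω} := by
  have : {ω : Config d | v ∈ cluster ω} = ⋃ n, ⋃ l ∈ paths d n, ⋃ (_ : l.headI = v),
      {ω : Config d | IsOpenPath ω l} := by
    ext ω
    simp only [cluster, Set.mem_ofPred_eq, Set.mem_iUnion, exists_prop]
  rw [this]
  exact MeasurableSet.iUnion fun n => Finset.measurableSet_biUnion _ fun l _ =>
    MeasurableSet.iUnion fun _ => measurableSet_isOpenPath l

theorem measurableSet_cluster_eq (F : Finset (Fin d → ℤ)) :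
    MeasurableSet {ω : Config d | cluster ω = F} := by
  have : {ω : Config d | cluster ω = F} = ⋂ v, {ω : Config d | v ∈ cluster ω ↔ v ∈ F} := by
    ext ω; simp [Set.ext_iff]
  rw [this]
  refine MeasurableSet.iInter fun v => ?_
  by_cases hv : v ∈ F
  · simpa [hv] using measurableSet_mem_cluster v
  · have : {ω : Config d | v ∈ cluster ω ↔ v ∈ F} = {ω : Config d | v ∈ cluster ω}ᶜ := by
      ext ω; simp [hv]
    rw [this]
    exact (measurableSet_mem_cluster v).compl

/-- The event is a cylinder that fixes finitely many distinct edges of the product measure. -/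
theorem measure_isOpenPath (p : I) {n : ℕ} {l : List (Fin d → ℤ)} (hl : l ∈ paths d n) :
    percMeasure d p {ω | IsOpenPath ω l} = ENNReal.ofReal ((p : ℝ) ^ (upEdges l).card) := by
  classical
  have hedge := fun e he => (mem_of_mem_upEdges hl e he).1
  have hset : {ω : Config d | IsOpenPath ω l} =
      Set.pi (((upEdges l).subtype fun e => e ∈ (lattice d).edgeSet : Finset _) : Set _)
        fun _ => {true} := by
    ext ω
    simp only [IsOpenPath, Set.mem_ofPred_eq, Set.mem_pi, Finset.mem_coe, Finset.mem_subtype,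
      Set.mem_singleton_iff]
    constructor
    · rintro h ⟨e, he⟩ heu
      exact (h e heu).2
    · intro h e he
      exact ⟨hedge e he, h ⟨e, hedge e he⟩ he⟩
  have hcard : ((upEdges l).subtype fun e => e ∈ (lattice d).edgeSet).card =
      (upEdges l).card := by
    rw [Finset.card_subtype, Finset.filter_true_of_mem hedge]
  rw [hset, percMeasure, Measure.infinitePi_pi _ fun _ _ => measurableSet_singleton _,
    Finset.prod_const, hcard]
  rw [ProbabilityTheory.bernoulliMeasure_apply_of_mem_of_notMem p (measurableSet_singleton _)
    (by simp) (by simp)]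
  rw [ENNReal.ofReal_pow p.2.1]
  congr 1
  rw [ENNReal.ofReal, Real.toNNReal_of_nonneg p.2.1]
  rfl

/-- Union bound over paths with a far end: the factor `u ^ r` splits off and the weights sum to a
geometric series, with the path of length zero counted apart. -/
theorem measure_exists_mem_cluster_le (hd : 1 ≤ d) (p : I) {u q : ℝ} (hu0 : 0 < u) (hu1 : u ≤ 1)
    (hq : 0 ≤ q) (hqu : q ≤ u) (hp : (p : ℝ) = q * u)
    (hρ : ((2 * d - 2 : ℕ) : ℝ) * q + u < 1) (r : ℝ) :
    percMeasure d p {ω | ∃ v ∈ cluster ω, r ≤ l1 v} ≤ ENNReal.ofReal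
      (u ^ r * (1 + ((2 * d : ℕ) * q + u) * (1 - (((2 * d - 2 : ℕ) : ℝ) * q + u))⁻¹)) := by
  classical
  set ρ := ((2 * d - 2 : ℕ) : ℝ) * q + u with hρdef
  have hρ0 : 0 ≤ ρ := by positivity
  have hsub : {ω : Config d | ∃ v ∈ cluster ω, r ≤ l1 v} ⊆ ⋃ n,
      ⋃ l ∈ (paths d n).filter fun l => r ≤ l1 l.headI, {ω : Config d | IsOpenPath ω l} := by
    rintro ω ⟨v, ⟨n, l, hl, rfl, hopen⟩, hr⟩
    simp only [Set.mem_iUnion]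
    exact ⟨n, l, Finset.mem_filter.2 ⟨hl, hr⟩, hopen⟩
  have hZ0 : ∀ n, 0 ≤ ∑ l ∈ paths d n, weight u q l := fun n =>
    Finset.sum_nonneg fun l _ => weight_nonneg hu0.le hq l
  have hur : 0 < u ^ r := Real.rpow_pos_of_pos hu0 r
  have hterm : ∀ n, percMeasure d p (⋃ l ∈ (paths d n).filter fun l => r ≤ l1 l.headI,
      {ω : Config d | IsOpenPath ω l}) ≤
      ENNReal.ofReal (u ^ r * ∑ l ∈ paths d n, weight u q l) := by
    intro n
    refine (measure_biUnion_finset_le _ _).trans ?_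
    rw [Finset.mul_sum, ENNReal.ofReal_sum_of_nonneg fun l _ =>
      mul_nonneg hur.le (weight_nonneg hu0.le hq l)]
    refine (Finset.sum_le_sum fun l hl => ?_).trans
      (Finset.sum_le_sum_of_subset (Finset.filter_subset _ _))
    obtain ⟨hl, hr⟩ := Finset.mem_filter.1 hl
    rw [measure_isOpenPath p hl]
    refine ENNReal.ofReal_le_ofReal ((pow_card_upEdges_le hu0.le hu1 hq hp hl).trans ?_)
    refine mul_le_mul_of_nonneg_right ?_ (weight_nonneg hu0.le hq l)
    rw [← Real.rpow_natCast]
    exact Real.rpow_le_rpow_of_exponent_ge hu0 hu1 hr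
  have hgeom := (hasSum_geometric_of_lt_one hρ0 hρ).mul_left ((2 * d : ℕ) * q + u)
  have hbound : ∀ n, ∑ l ∈ paths d n, weight u q l ≤
      if n = 0 then 1 else ((2 * d : ℕ) * q + u) * ρ ^ (n - 1) := by
    intro n
    cases n with
    | zero => simp [paths, weight]
    | succ n => simpa using sum_weight_paths_le hd hu0.le hq hqu n
  have hsum : HasSum (fun n => u ^ r * if n = 0 then 1 else ((2 * d : ℕ) * q + u) * ρ ^ (n - 1))
      (u ^ r * (1 + ((2 * d : ℕ) * q + u) * (1 - ρ)⁻¹)) := by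
    refine HasSum.mul_left _ ?_
    have := (hasSum_nat_add_iff' (f := fun n : ℕ => if n = 0 then (1 : ℝ)
      else ((2 * d : ℕ) * q + u) * ρ ^ (n - 1)) 1
      (g := 1 + ((2 * d : ℕ) * q + u) * (1 - ρ)⁻¹)).1
    apply this
    simpa using hgeom
  calc percMeasure d p {ω | ∃ v ∈ cluster ω, r ≤ l1 v}
      ≤ ∑' n, percMeasure d p (⋃ l ∈ (paths d n).filter fun l => r ≤ l1 l.headI,
        {ω : Config d | IsOpenPath ω l}) := (measure_mono hsub).trans (measure_iUnion_le _)
    _ ≤ ∑' n, ENNReal.ofReal (u ^ r * if n = 0 then 1 else ((2 * d : ℕ) * q + u) * ρ ^ (n - 1)) :=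
        ENNReal.tsum_le_tsum fun n => (hterm n).trans (ENNReal.ofReal_le_ofReal
          (mul_le_mul_of_nonneg_left (hbound n) hur.le))
    _ = _ := by
        rw [← ENNReal.ofReal_tsum_of_nonneg _ hsum.summable, hsum.tsum_eq]
        intro n
        refine mul_nonneg hur.le ?_
        split_ifs <;> positivity

theorem finite_setOf_l1_lt (r : ℝ) : {v : Fin d → ℤ | (l1 v : ℝ) < r}.Finite := by
  obtain ⟨N, hN⟩ := exists_nat_gt r
  refine (Set.finite_Icc (fun _ : Fin d => -(N : ℤ)) (fun _ => (N : ℤ))).subset fun v hv => ?_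
  have h1 : l1 v < N := by
    have : (l1 v : ℝ) < N := lt_trans hv hN
    exact_mod_cast this
  have h2 : ∀ i, (v i).natAbs ≤ l1 v := fun i =>
    Finset.single_le_sum (f := fun i => (v i).natAbs) (fun _ _ => Nat.zero_le _) (Finset.mem_univ i)
  exact ⟨fun i => by have := h2 i; show -(N : ℤ) ≤ v i; omega,
    fun i => by have := h2 i; show v i ≤ (N : ℤ); omega⟩

open Classical in
/-- The random sphere: the surface around the cluster of the origin, if that cluster is finite. -/
def randomSphere (ω : Config d) : Set (EuclideanSpace ℝ (Fin d)) :=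
  if h : (cluster ω).Finite then surface h.toFinset else ∅

/-- Apart from the empty set there is one value for each finite cluster, and finite sets of vertices
are countable in number. -/
theorem isMeasurableSetValued_randomSphere : IsMeasurableSetValued (randomSphere (d := d)) := by
  intro U _
  have : {ω : Config d | (randomSphere ω ∩ U).Nonempty} =
      ⋃ F : Finset (Fin d → ℤ), ⋃ (_ : (surface F ∩ U).Nonempty), {ω | cluster ω = F} := by
    ext ω
    simp only [Set.mem_ofPred_eq, Set.mem_iUnion]
    constructor
    · intro h
      unfold randomSphere at h
      split_ifs at h with hf
      · exact ⟨hf.toFinset, h, by simp⟩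
      · simp at h
    · rintro ⟨F, hF, hω⟩
      have hf : (cluster ω).Finite := by rw [hω]; exact F.finite_toSet
      have : hf.toFinset = F := by
        rw [← Finset.coe_inj, Set.Finite.coe_toFinset, hω]
      unfold randomSphere
      rw [dif_pos hf, this]
      exact hF
  rw [this]
  exact MeasurableSet.iUnion fun F => MeasurableSet.iUnion fun _ => measurableSet_cluster_eq F

end Cluster

/-! ### Tail bound, almost sure finiteness, and the case `p = 1` -/

section Tail

variable {d : ℕ}

theorem exists_tail_bound (hd : 2 ≤ d) (p : I) {α : ℝ}
    (hα : Real.sqrt (8 * (p : ℝ) * ((d : ℝ) - 1)) < α) (hα1 : α < 1) :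
    ∃ C : ℝ, 0 < C ∧ ∀ r : ℝ, 0 ≤ r →
      percMeasure d p {ω | ∃ v ∈ cluster ω, r ≤ l1 v + d} ≤ ENNReal.ofReal (C * α ^ r) := by
  have hp := p.2.1
  have hα0 : 0 < α := (Real.sqrt_nonneg _).trans_lt hα
  have hd' : (1 : ℝ) ≤ (d : ℝ) - 1 := by
    have : (2 : ℝ) ≤ d := by exact_mod_cast hd
    linarith
  have hsq : 8 * (p : ℝ) * ((d : ℝ) - 1) < α ^ 2 := (Real.sqrt_lt' hα0).1 hα
  -- With `q = p / u` the ratio is `4 p (d - 1) / α + α / 2`, and `hsq` says exactly that the first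
  -- term is below `α / 2`; so the ratio is below `α`.
  set u := α / 2 with hu
  set q := (p : ℝ) / u with hq
  have hu0 : 0 < u := by positivity
  have hq0 : 0 ≤ q := by positivity
  have hpq : (p : ℝ) = q * u := by rw [hq, div_mul_cancel₀ _ hu0.ne']
  have hqu : q ≤ u := by
    rw [hq, div_le_iff₀ hu0, hu]
    nlinarith
  have hcast : ((2 * d - 2 : ℕ) : ℝ) = 2 * ((d : ℝ) - 1) := by
    rw [Nat.cast_sub (by omega)]; push_cast; ring
  have hρ : ((2 * d - 2 : ℕ) : ℝ) * q + u < 1 := by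
    have h1 : ((2 * d - 2 : ℕ) : ℝ) * q < u := by
      rw [hcast, hq, ← mul_div_assoc, div_lt_iff₀ hu0, hu]
      nlinarith
    linarith
  have hK : 0 < 1 + ((2 * d : ℕ) * q + u) * (1 - (((2 * d - 2 : ℕ) : ℝ) * q + u))⁻¹ := by
    have : 0 < (1 - (((2 * d - 2 : ℕ) : ℝ) * q + u))⁻¹ := inv_pos.2 (by linarith)
    positivity
  -- The factor `u ^ (-d)` pays for the slack `d` between the radius of the surface and the ℓ¹-norms
  -- in the cluster.
  refine ⟨u ^ (-(d : ℝ)) * (1 + ((2 * d : ℕ) * q + u) *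
    (1 - (((2 * d - 2 : ℕ) : ℝ) * q + u))⁻¹), mul_pos (Real.rpow_pos_of_pos hu0 _) hK,
    fun r hr => ?_⟩
  have h := measure_exists_mem_cluster_le (by omega : 1 ≤ d) p hu0 (by linarith) hq0 hqu hpq hρ
    (r - d)
  simp only [sub_le_iff_le_add] at h
  refine h.trans (ENNReal.ofReal_le_ofReal ?_)
  rw [sub_eq_add_neg, Real.rpow_add hu0]
  have h1 : u ^ r ≤ α ^ r := Real.rpow_le_rpow hu0.le (by linarith) hr
  have h2 : 0 < u ^ (-(d : ℝ)) := Real.rpow_pos_of_pos hu0 _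
  have h3 := mul_le_mul_of_nonneg_right h1 (mul_pos h2 hK).le
  linarith

/-- An infinite cluster leaves every ℓ¹-ball, as balls contain finitely many vertices, and the tail
bound tends to zero. -/
theorem ae_finite_cluster (p : I) {C α : ℝ} (hα0 : 0 ≤ α) (hα1 : α < 1)
    (h : ∀ r : ℝ, 0 ≤ r →
      percMeasure d p {ω | ∃ v ∈ cluster ω, r ≤ l1 v + d} ≤ ENNReal.ofReal (C * α ^ r)) :
    ∀ᵐ ω ∂(percMeasure d p), (cluster ω).Finite := by
  rw [ae_iff]
  have hle : ∀ n : ℕ, percMeasure d p {ω | ¬ (cluster ω).Finite} ≤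
      ENNReal.ofReal (C * α ^ n) := by
    intro n
    have h1 := h n (Nat.cast_nonneg n)
    rw [Real.rpow_natCast] at h1
    refine (measure_mono fun ω hω => ?_).trans h1
    by_contra hc
    apply hω
    refine (finite_setOf_l1_lt (n : ℝ)).subset fun v hv => ?_
    by_contra hv'
    refine hc ⟨v, hv, ?_⟩
    rw [Set.mem_ofPred_eq, not_lt] at hv'
    have : (0 : ℝ) ≤ d := Nat.cast_nonneg d
    linarith
  have hlim : Filter.Tendsto (fun n : ℕ => ENNReal.ofReal (C * α ^ n)) Filter.atTop
      (nhds (ENNReal.ofReal (C * 0))) :=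
    ENNReal.tendsto_ofReal ((tendsto_pow_atTop_nhds_zero_of_lt_one hα0 hα1).const_mul C)
  rw [mul_zero, ENNReal.ofReal_zero] at hlim
  exact le_antisymm (ge_of_tendsto' hlim hle) zero_le

theorem isClosedSphereAroundOrigin_randomSphere {ω : Config d} (h : (cluster ω).Finite) :
    IsClosedSphereAroundOrigin ω (randomSphere ω) := by
  unfold randomSphere
  rw [dif_pos h]
  exact isClosedSphereAroundOrigin_surface_cluster h

theorem exists_mem_cluster_of_le_rad {ω : Config d} {r : ℝ} (hr : 0 < r)
    (h : ENNReal.ofReal r ≤ rad (randomSphere ω)) : ∃ v ∈ cluster ω, r ≤ l1 v + d := by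
  unfold randomSphere at h
  split_ifs at h with hf
  · obtain ⟨v, hv, hvr⟩ := exists_le_l1_of_le_rad_surface (isComb_cluster hf) h
    exact ⟨v, by simpa using hv, hvr⟩
  · simp [rad] at h
    linarith

/-- A coordinate half-axis is covered by bonds, all open, so it avoids `A` and makes the component
of the origin unbounded. -/
theorem not_isClosedSphereAroundOrigin_of_all_open (hd : 1 ≤ d)
    (A : Set (EuclideanSpace ℝ (Fin d))) :
    ¬ IsClosedSphereAroundOrigin (fun _ => true : Config d) A := by
  rintro ⟨-, -, ⟨h0, hbd⟩, hclosed⟩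
  let k : Fin d := ⟨0, hd⟩
  have hray : ∀ t : ℝ, 0 ≤ t → (EuclideanSpace.single k t : EuclideanSpace ℝ (Fin d)) ∈ Aᶜ := by
    intro t ht hA
    have hadj : (lattice d).Adj (Pi.single k ⌊t⌋) (Pi.single k (⌊t⌋ + 1)) := by
      have := adj_update (v := Pi.single k ⌊t⌋) (k := k) (ε := 1) (by norm_num)
      simpa [Pi.single, Function.update_idem] using this
    have := hclosed _ _ hadj ⟨EuclideanSpace.single k t, ?_, hA⟩
    · exact absurd this (by simp)
    · rw [bond, segment_eq_image]
      refine ⟨Int.fract t, ⟨Int.fract_nonneg t, (Int.fract_lt_one t).le⟩, ?_⟩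
      ext i
      by_cases hi : i = k
      · subst hi
        simp [toSpace]
        have := Int.floor_add_fract t
        linear_combination this
      · simp [toSpace, hi]
  have hcont : Continuous fun t : ℝ => (EuclideanSpace.single k t : EuclideanSpace ℝ (Fin d)) := by
    have : Continuous fun t : ℝ => (Pi.single k t : Fin d → ℝ) :=
      continuous_single (A := fun _ : Fin d => ℝ) k
    exact (PiLp.continuous_toLp 2 _).comp this
  have hpre : IsPreconnected ((fun t : ℝ => (EuclideanSpace.single k t :
      EuclideanSpace ℝ (Fin d))) '' Set.Ici 0) :=
    isPreconnected_Ici.image _ hcont.continuousOn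
  have hsub := hpre.subset_connectedComponentIn (x := 0) (F := Aᶜ)
    ⟨0, Set.self_mem_Ici, by simp⟩ (by rintro _ ⟨t, ht, rfl⟩; exact hray t ht)
  obtain ⟨R, hR⟩ := isBounded_iff_forall_norm_le.1 (hbd.subset hsub)
  have := hR _ ⟨|R| + 1, by simp only [Set.mem_Ici]; positivity, rfl⟩
  rw [PiLp.norm_single, Real.norm_of_nonneg (by positivity)] at this
  linarith [le_abs_self R]

theorem percMeasure_one_sphereEvent (hd : 1 ≤ d) : percMeasure d 1 (sphereEvent d) = 0 := by
  have h : percMeasure d 1 = Measure.dirac fun _ => true := by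
    simp only [percMeasure, ProbabilityTheory.bernoulliMeasure_one]
    exact Measure.infinitePi_dirac _
  rw [h, Measure.dirac_apply]
  refine Set.indicator_of_notMem ?_ _
  rintro ⟨A, hA⟩
  exact not_isClosedSphereAroundOrigin_of_all_open hd A hA

end Tail

end SpherePercolation

theorem theorem2p1 (d : ℕ) (hd : 3 ≤ d) :
    1 / (8 * ((d : ℝ) - 1)) ≤ SpherePercolation.criticalProb d ∧
    ∀ p : unitInterval, (p : ℝ) < 1 / (8 * ((d : ℝ) - 1)) →
      ∀ α : ℝ, Real.sqrt (8 * (p : ℝ) * ((d : ℝ) - 1)) < α → α < 1 →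
        ∃ C : ℝ, 0 < C ∧
        ∃ S : SpherePercolation.Config d → Set (EuclideanSpace ℝ (Fin d)),
          SpherePercolation.IsMeasurableSetValued S ∧
          (∀ᵐ ω ∂(SpherePercolation.percMeasure d p),
            SpherePercolation.IsClosedSphereAroundOrigin ω (S ω)) ∧
          ∀ r : ℝ, 0 < r →
            (SpherePercolation.percMeasure d p).real
              {ω | ENNReal.ofReal r ≤ SpherePercolation.rad (S ω)} ≤ C * α ^ r := by
  open SpherePercolation in
  have hmain : ∀ p : unitInterval, ∀ α : ℝ, Real.sqrt (8 * (p : ℝ) * ((d : ℝ) - 1)) < α → α < 1 →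
      ∃ C : ℝ, 0 < C ∧ (∀ᵐ ω ∂(percMeasure d p), IsClosedSphereAroundOrigin ω (randomSphere ω)) ∧
        ∀ r : ℝ, 0 < r →
          (percMeasure d p).real {ω | ENNReal.ofReal r ≤ rad (randomSphere ω)} ≤ C * α ^ r := by
    intro p α hα hα1
    have hα0 : 0 < α := (Real.sqrt_nonneg _).trans_lt hα
    obtain ⟨C, hC, htail⟩ := exists_tail_bound (by omega : 2 ≤ d) p hα hα1
    refine ⟨C, hC, ?_, fun r hr => ?_⟩
    · filter_upwards [ae_finite_cluster p hα0.le hα1 htail] with ω hω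
      exact isClosedSphereAroundOrigin_randomSphere hω
    · refine ENNReal.toReal_le_of_le_ofReal (by positivity) ((measure_mono ?_).trans
        (htail r hr.le))
      exact fun ω hω => exists_mem_cluster_of_le_rad hr hω
  have hd1 : (0 : ℝ) < 8 * ((d : ℝ) - 1) := by
    have : (3 : ℝ) ≤ d := by exact_mod_cast hd
    linarith
  constructor
  -- The point `p = 1` shows that the set is nonempty; this matters because the infimum of the empty
  -- set is zero by default.
  · refine le_csInf ⟨1, unitInterval.one_mem,
      SpherePercolation.percMeasure_one_sphereEvent (by omega)⟩ ?_
    rintro p ⟨hp, hp0⟩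
    by_contra! hlt
    rw [lt_div_iff₀ hd1] at hlt
    obtain ⟨α, hα, hα1⟩ := exists_between (show Real.sqrt (8 * p * ((d : ℝ) - 1)) < 1 by
      rw [Real.sqrt_lt' one_pos]; linarith)
    obtain ⟨C, -, hae, -⟩ := hmain ⟨p, hp⟩ α hα hα1
    have hnot := measure_eq_zero_iff_ae_notMem.1 hp0
    obtain ⟨ω, h1, h2⟩ := (hae.and hnot).exists
    exact h2 ⟨_, h1⟩
  · intro p _ α hα hα1
    obtain ⟨C, hC, hae, htail⟩ := hmain p α hα hα1
    exact ⟨C, hC, SpherePercolation.randomSphere,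
      SpherePercolation.isMeasurableSetValued_randomSphere, hae, htail⟩
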